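/- **Theorem.** Let $H$ be a finite abelian group, let $k\ge 3$, and let $\psi\subsetneq H^k$ be a proper subgroup that is balanced and pairwise independent: for a uniformly random $a\in\psi$ each coordinate $a_i$ is uniform on $H$, and any two coordinates $a_i,a_j$ with $i\ne j$ are independent. An instance of $\mathsf{Additive\text{-}CSP}(\psi)$ with $n$ variables $x_1,\dots,x_n$ and $m$ constraints is a sequence of $m$ constraints $\psi(x_{j_1}+a_1,\dots,x_{j_k}+a_k)=1$ with distinct indices $j_1,\dots,j_k$ and with $a_1,\dots,a_k\in H$; in a random instance the constraints are independent and uniform. An instance is $\alpha$-satisfiable if some assignment of elements of $H$ to the variables satisfies at least $\alpha m$ constraints. For $\epsilon>0$ and a positive integer $\Delta$, a time-$T(n)$ *refuter* with parameters $(\epsilon,\Delta)$ is an algorithm that runs in time $T(n)$ on the instances with $n$ variables and $\Delta n$ constraints, outputs "typical" on a random such instance with probability tending to $1$ as $n\to\infty$, and never outputs "typical" on such an instance that is $(1-\epsilon)$-satisfiable. The *Random $\mathsf{Additive\text{-}CSP}(\psi)$ Hypothesis* says that for all $\epsilon>0$ and all positive integers $\Delta$ there is no polynomial-time refuter with parameters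 $(\epsilon,\Delta)$. Two graphs $G,G'$ on the same number of vertices are $\alpha$-isomorphic if there is an $\alpha$-isomorphism between them, that is, a bijection $\pi:V(G)\to V(G')$ with $|\{e\in E(G):\pi(e)\in E(G')\}|\ \ge\ \alpha\max\{|E(G)|,|E(G')|\}$, where for two graphs without edges every bijection counts as a $1$-isomorphism but not as an $\alpha$-isomorphism for $\alpha>1$. An algorithm solves $\mathsf{RobustGiso}$ if there is a function $r:[0,1]\to[0,1]$ with $r(\epsilon)\to0$ as $\epsilon\to0^+$ such that for every $\epsilon \in [0,1]$, on every $(1-\epsilon)$-isomorphic pair of graphs it outputs a $(1-r(\epsilon))$-isomorphism. Graphs are given by edge lists, instances by the list of their constraints, and running times are those of a unit-cost random access machine with addition and subtraction, measured in the number $n$ of vertices, respectively of variables. 1. Assume the Random $\mathsf{Additive\text{-}CSP}(\psi)$ Hypothesis. Then there is no polynomial-time algorithm for $\mathsf{RobustGiso}$. 2. More precisely, there are a real $\delta>0$, a positive integer $\Delta$, and constants $K,a,b\in\mathbb N$, all depending only on $\psi$ (and $H$, $k$), such that the following holds for every $\epsilon>0$ and every function $t:\mathbb N\to\mathbb N$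 with $t(n)\ge n$ for all $n$. Suppose there is an algorithm that, on all pairs of $n$-vertex graphs with the same number $m\le Kn$ of edges each, runs in time $t(n)$, accepts the $(1-\epsilon)$-isomorphic pairs, and rejects the pairs that are not $(1-\delta)$-isomorphic. Then there is a refuter with parameters $(\epsilon,\Delta)$ with running time $a\,t(bn)+a$, that is, $t(O(n))$. -/

import Mathlib

open Filter Topology

/-! ## Machine model: structured random access machine programs with a step count -/

/-- Programs of a random access machine.  The machine has registers `x 0, x 1, …` and arrays
`A 0, A 1, …`, all of whose cells hold natural numbers.  A program is a finite piece of text, so it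
names finitely many registers and arrays; array cells are addressed indirectly.  The only
arithmetic operations are addition and truncated subtraction, so that at unit cost polynomial
time on this machine is the usual polynomial time. -/
inductive RamProg : Type
  /-- `x i := c` -/
  | const (i c : ℕ) : RamProg
  /-- `x i := x j + x l` -/
  | add (i j l : ℕ) : RamProg
  /-- `x i := max (x j - x l) 0` -/
  | sub (i j l : ℕ) : RamProg
  /-- `x i := A a [x j]` -/
  | load (i a j : ℕ) : RamProg
  /-- `A a [x i] := x j` -/
  | store (a i j : ℕ) : RamProg
  /-- first the one program, then the other -/
  | seq (p q : RamProg) : RamProg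
  /-- if `x i ≠ 0` then the one program, else the other -/
  | ite (i : ℕ) (p q : RamProg) : RamProg
  /-- while `x i ≠ 0` repeat the program -/
  | loop (i : ℕ) (p : RamProg) : RamProg

/-- The memory of the machine. -/
@[ext]
structure RamState : Type where
  /-- contents of the registers -/
  reg : ℕ → ℕ
  /-- contents of the arrays: `arr a x` is the cell of array `a` with address `x` -/
  arr : ℕ → ℕ → ℕ

namespace RamState

/-- Overwrite register `i` by `v`. -/
def setReg (σ : RamState) (i v : ℕ) : RamState :=
  { σ with reg := Function.update σ.reg i v }

/-- Overwrite the cell with address `x` of array `a` by `v`. -/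
def setArr (σ : RamState) (a x v : ℕ) : RamState :=
  { σ with arr := Function.update σ.arr a (Function.update (σ.arr a) x v) }

/-- The initial memory on input `w`: the words of `w` stand in array `0`, all else is `0`. -/
def initial (w : List ℕ) : RamState where
  reg := fun _ => 0
  arr := fun a x => if a = 0 then w.getD x 0 else 0

end RamState

/-- `RamExec p σ s σ'`: started in memory `σ`, the program `p` halts after exactly `s` steps with
memory `σ'`.  Every elementary instruction and every test of a conditional or of a loop is one
step. -/
inductive RamExec : RamProg → RamState → ℕ → RamState → Prop
  | const (i c : ℕ) (σ : RamState) : RamExec (.const i c) σ 1 (σ.setReg i c)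
  | add (i j l : ℕ) (σ : RamState) :
      RamExec (.add i j l) σ 1 (σ.setReg i (σ.reg j + σ.reg l))
  | sub (i j l : ℕ) (σ : RamState) :
      RamExec (.sub i j l) σ 1 (σ.setReg i (σ.reg j - σ.reg l))
  | load (i a j : ℕ) (σ : RamState) :
      RamExec (.load i a j) σ 1 (σ.setReg i (σ.arr a (σ.reg j)))
  | store (a i j : ℕ) (σ : RamState) :
      RamExec (.store a i j) σ 1 (σ.setArr a (σ.reg i) (σ.reg j))
  | seq {p q : RamProg} {σ σ' σ'' : RamState} {s s' : ℕ}
      (hp : RamExec p σ s σ') (hq : RamExec q σ' s' σ'') :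
      RamExec (.seq p q) σ (s + s') σ''
  | ite_true {i : ℕ} {p q : RamProg} {σ σ' : RamState} {s : ℕ}
      (hi : σ.reg i ≠ 0) (hp : RamExec p σ s σ') : RamExec (.ite i p q) σ (s + 1) σ'
  | ite_false {i : ℕ} {p q : RamProg} {σ σ' : RamState} {s : ℕ}
      (hi : σ.reg i = 0) (hq : RamExec q σ s σ') : RamExec (.ite i p q) σ (s + 1) σ'
  | loop_stop {i : ℕ} {p : RamProg} {σ : RamState}
      (hi : σ.reg i = 0) : RamExec (.loop i p) σ 1 σ
  | loop_step {i : ℕ} {p : RamProg} {σ σ' σ'' : RamState} {s s' : ℕ}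
      (hi : σ.reg i ≠ 0) (hp : RamExec p σ s σ') (hl : RamExec (.loop i p) σ' s' σ'') :
      RamExec (.loop i p) σ (s + s' + 1) σ''

namespace RamProg

/-- On input `w` the program halts after at most `T` steps. -/
def HaltsWithin (P : RamProg) (w : List ℕ) (T : ℕ) : Prop :=
  ∃ s ≤ T, ∃ σ, RamExec P (RamState.initial w) s σ

/-- On input `w` the program halts with memory `σ`. -/
def HaltsWith (P : RamProg) (w : List ℕ) (σ : RamState) : Prop :=
  ∃ s, RamExec P (RamState.initial w) s σ

/-- On input `w` the program halts with answer "yes" (a nonzero number in register `0`). -/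
def Accepts (P : RamProg) (w : List ℕ) : Prop :=
  ∃ σ, P.HaltsWith w σ ∧ σ.reg 0 ≠ 0

/-- On input `w` the program halts with answer "no" (zero in register `0`). -/
def Rejects (P : RamProg) (w : List ℕ) : Prop :=
  ∃ σ, P.HaltsWith w σ ∧ σ.reg 0 = 0

end RamProg

/-! ## Approximate graph isomorphism -/

section Giso

/-- The fraction `GI(G, G'; π)` of edges that the bijection `π` satisfies, relative to the larger
of the two numbers of edges.  It is `1` if neither graph has an edge (then `π` is an
isomorphism). -/
noncomputable def graphIsoValue {V W : Type*} (G : SimpleGraph V) (G' : SimpleGraph W)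
    (π : V ≃ W) : ℝ :=
  if max G.edgeSet.ncard G'.edgeSet.ncard = 0 then 1
  else ({e ∈ G.edgeSet | e.map π ∈ G'.edgeSet}.ncard : ℝ) /
    (max G.edgeSet.ncard G'.edgeSet.ncard : ℕ)

/-- `π` is an `α`-isomorphism. -/
def IsApproxIso {V W : Type*} (α : ℝ) (G : SimpleGraph V) (G' : SimpleGraph W) (π : V ≃ W) :
    Prop :=
  α ≤ graphIsoValue G G' π

/-- `G` and `G'` are `α`-isomorphic: the maximum of `GI(G, G'; π)` over all bijections `π` is at
least `α`. -/
def ApproxIsomorphic {V W : Type*} (α : ℝ) (G : SimpleGraph V) (G' : SimpleGraph W) : Prop :=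
  ∃ π : V ≃ W, IsApproxIso α G G' π

/-- `l` lists the edges of `G`, each exactly once, in any order and with any orientation. -/
def IsEdgeListing {n : ℕ} (G : SimpleGraph (Fin n)) (l : List (Fin n × Fin n)) : Prop :=
  (l.map fun p => s(p.1, p.2)).Nodup ∧ ∀ e, e ∈ (l.map fun p => s(p.1, p.2)) ↔ e ∈ G.edgeSet

/-- The words of a list of pairs of vertices. -/
def edgeWords {n : ℕ} (l : List (Fin n × Fin n)) : List ℕ :=
  l.flatMap fun p => [(p.1 : ℕ), (p.2 : ℕ)]

/-- `w` presents the pair `(G, G')` to a machine: the number of vertices, the two numbers of edges,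
and then an edge list of either graph. -/
def IsPairEncoding {n : ℕ} (G G' : SimpleGraph (Fin n)) (w : List ℕ) : Prop :=
  ∃ l l' : List (Fin n × Fin n), IsEdgeListing G l ∧ IsEdgeListing G' l' ∧
    w = n :: l.length :: l'.length :: (edgeWords l ++ edgeWords l')

/-- `P` solves the robust graph isomorphism problem: for some `r` with `r(ε) → 0` as `ε → 0⁺`, on
every `(1-ε)`-isomorphic pair of graphs it outputs (in array `1`) a `(1-r(ε))`-isomorphism. -/
def SolvesRobustGiso (P : RamProg) : Prop :=
  ∃ r : unitInterval → unitInterval, Tendsto r (𝓝[>] 0) (𝓝 0) ∧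
    ∀ (ε : unitInterval) (n : ℕ) (G G' : SimpleGraph (Fin n)) (w : List ℕ),
      IsPairEncoding G G' w → ApproxIsomorphic (1 - (ε : ℝ)) G G' →
      ∃ σ, P.HaltsWith w σ ∧ ∃ π : Fin n ≃ Fin n, (∀ v : Fin n, σ.arr 1 v = (π v : ℕ)) ∧
        IsApproxIso (1 - (r ε : ℝ)) G G' π

/-- `P` runs in time polynomial in the number of vertices on all pairs of graphs. -/
def IsPolyTimeOnGraphPairs (P : RamProg) : Prop :=
  ∃ p : Polynomial ℕ, ∀ (n : ℕ) (G G' : SimpleGraph (Fin n)) (w : List ℕ),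
    IsPairEncoding G G' w → P.HaltsWithin w (p.eval n)

/-- On pairs of graphs with `n` vertices and the same number `m ≤ K n` of edges each, `P` runs in
time `t n`, accepts the `(1-ε)`-isomorphic pairs, and rejects the pairs that are not
`(1-δ)`-isomorphic. -/
def Distinguishes (P : RamProg) (ε δ : ℝ) (K : ℕ) (t : ℕ → ℕ) : Prop :=
  ∀ (n m : ℕ) (G G' : SimpleGraph (Fin n)) (w : List ℕ),
    G.edgeSet.ncard = m → G'.edgeSet.ncard = m → m ≤ K * n → IsPairEncoding G G' w →
    P.HaltsWithin w (t n) ∧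
    (ApproxIsomorphic (1 - ε) G G' → P.Accepts w) ∧
    (¬ ApproxIsomorphic (1 - δ) G G' → P.Rejects w)

end Giso

/-! ## Additive constraint satisfaction problems -/

section AdditiveCSP

variable {H : Type*} {k : ℕ}

/-- The probability of the event `E` for a uniformly random element of `ψ`. -/
noncomputable def uniformProb (ψ E : Set (Fin k → H)) : ℝ :=
  ((ψ ∩ E).ncard : ℝ) / (ψ.ncard : ℝ)

/-- `ψ` is a subgroup of `H^k`, and for a uniformly random `a ∈ ψ` each coordinate is uniformly
distributed over `H` and any two different coordinates are independent. -/
structure IsBalancedPairwiseIndependentSubgroup [AddCommGroup H] [Fintype H]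
    (ψ : Set (Fin k → H)) : Prop where
  subgroup : ∃ S : AddSubgroup (Fin k → H), (S : Set (Fin k → H)) = ψ
  uniform : ∀ (i : Fin k) (b : H), uniformProb ψ {a | a i = b} = 1 / (Fintype.card H : ℝ)
  indep : ∀ i j : Fin k, i ≠ j → ∀ b c : H,
    uniformProb ψ {a | a i = b ∧ a j = c} =
      uniformProb ψ {a | a i = b} * uniformProb ψ {a | a j = c}

/-- A constraint `ψ(x_{j_1} + a_1, …, x_{j_k} + a_k) = 1` over the variables `x_0, …, x_{n-1}`: the
`k` different indices `j_i` and the `k` group elements `a_i`. -/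
abbrev AdditiveConstraint (k : ℕ) (H : Type*) (n : ℕ) : Type _ :=
  (Fin k ↪ Fin n) × (Fin k → H)

/-- An instance with `n` variables and `m` constraints. -/
abbrev AdditiveInstance (k : ℕ) (H : Type*) (n m : ℕ) : Type _ :=
  Fin m → AdditiveConstraint k H n

/-- The assignment `τ` satisfies the constraint `c`. -/
def ConstraintSatisfied [Add H] (ψ : Set (Fin k → H)) {n : ℕ} (c : AdditiveConstraint k H n)
    (τ : Fin n → H) : Prop :=
  (fun i => τ (c.1 i) + c.2 i) ∈ ψ

/-- Some assignment satisfies at least `α m` of the `m` constraints. -/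
def IsSatisfiableFraction [Add H] (ψ : Set (Fin k → H)) (α : ℝ) {n m : ℕ}
    (C : AdditiveInstance k H n m) : Prop :=
  ∃ τ : Fin n → H, α * (m : ℝ) ≤ ({i | ConstraintSatisfied ψ (C i) τ}.ncard : ℝ)

/-- The words of a constraint: its variables, then its group elements in a fixed numbering of
`H`. -/
noncomputable def constraintWords [Fintype H] {n : ℕ} (c : AdditiveConstraint k H n) : List ℕ :=
  List.ofFn (fun i => (c.1 i : ℕ)) ++ List.ofFn (fun i => (Fintype.equivFin H (c.2 i) : ℕ))

/-- The input that presents an instance to a machine: the number of variables, the number of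
constraints, and then the constraints one after the other. -/
noncomputable def instanceWords [Fintype H] {n m : ℕ} (C : AdditiveInstance k H n m) : List ℕ :=
  n :: m :: (List.ofFn C).flatMap constraintWords

/-- `P` is a refuter with running time `T n` for instances with `n` variables and `Δ n` constraints:
it answers (where acceptance is the output "typical") on all of them, it outputs "typical" on almost
all of them (a fraction tending to `1` of all instances, which are equally likely), and it never
outputs "typical" on an instance with an assignment that satisfies at least `(1-ε) Δ n`
constraints. -/
structure IsRefuter [AddCommGroup H] [Fintype H] (ψ : Set (Fin k → H)) (ε : ℝ) (Δ : ℕ)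
    (T : ℕ → ℕ) (P : RamProg) : Prop where
  time : ∀ (n : ℕ) (C : AdditiveInstance k H n (Δ * n)), P.HaltsWithin (instanceWords C) (T n)
  almost_all : Tendsto
    (fun n : ℕ =>
      ({C : AdditiveInstance k H n (Δ * n) | P.Accepts (instanceWords C)}.ncard : ℝ) /
        (Nat.card (AdditiveInstance k H n (Δ * n)) : ℝ)) atTop (𝓝 1)
  never : ∀ (n : ℕ) (C : AdditiveInstance k H n (Δ * n)),
    IsSatisfiableFraction ψ (1 - ε) C → ¬ P.Accepts (instanceWords C)

/-- The random additive CSP hypothesis: for no `ε > 0` and positive integer `Δ` is there a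
polynomial-time refuter. -/
def RandomAdditiveCSPHypothesis [AddCommGroup H] [Fintype H] (ψ : Set (Fin k → H)) : Prop :=
  ∀ (ε : ℝ) (Δ : ℕ), 0 < ε → 0 < Δ →
    ¬ ∃ (P : RamProg) (p : Polynomial ℕ), IsRefuter ψ ε Δ (fun n => p.eval n) P

end AdditiveCSP

/-! ## Determinism, relocation and time bounds of programs -/

/-! The reduction. Write ψ = S, d = |H|, s = |S|. From an instance C build a bipartite graph with
variable vertices (i, h), h ∈ H, and constraint vertices (c, t), t ∈ S, where (c, t) is joined to
(j_l, t_l - a_l) for each coordinate l of the constraint c. The partner graph comes from the same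
instance with all shifts a set to 0.

Completeness (`approxIsomorphic_of_isSatisfiableFraction`). If τ satisfies c, then p = (τ(j_l) +
a_l)_l lies in S. The translations (i, h) ↦ (i, h - τ_i) and (c, t) ↦ (c, t - p) carry all s·k edges
of c to edges, so the fraction of satisfied constraints is a lower bound for the fraction of
preserved edges.

Soundness (`exists_starPreserved_of_approxIsomorphic`, `exists_ncard_starPreserved_le`). A (1 -
1/(8sk))-isomorphism loses at most m/8 edges. Apart from at most m/8 + nd constraints, it therefore
maps the star of (c, 0), with leaves (j_l, -a_l), to a star of some (c', t') in the partner graph.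
Let f be its restriction to the variable vertices; there are n^{O(n)} maps f, with leading exponent
dn. A union bound over f treats the preserved stars by type. If c' ≠ c, then f, C c' and O(n²)
bookkeeping choices determine C c, which is one of about n^k constraints. As k ≥ 3, each such star
saves a factor of order n, and (d+1)n of them beat the n^{dn} maps. If c' = c but some leaf moves to
another variable of c, then f makes a coincidence of probability O(1/n) happen; again (d+1)n of
these are too many. If c' = c and every leaf stays over its variable, only the partial permutations
of H over the single variables matter. There are at most (d+1)^{dn} families of them, and for a
fixed family a random constraint matches with probability at most |S|/d^k ≤ 1/2, as S is proper. So
for Δ large, three quarters of the Δn constraints rarely match. Hence only a fraction O(2^{-n}) of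
the instances yield approximately isomorphic pairs.

The machine side. The refuter writes the two graphs in linear time, runs the given program in a
fresh part of the memory (`RamExec.shift`) and answers the opposite. For the first claim, a robust
solver becomes a distinguisher (`distinguishes_verifyProg`) by checking its output: for small ε its
loss r(ε) is below the soundness gap. Determinism makes acceptance and rejection exclude each other.
-/

theorem RamExec.deterministic {p : RamProg} {σ σ' : RamState} {s : ℕ} (h : RamExec p σ s σ') :
    ∀ {s₂ : ℕ} {σ₂ : RamState}, RamExec p σ s₂ σ₂ → s = s₂ ∧ σ' = σ₂ := by
  induction h with
  | const | add | sub | load | store => intro s₂ σ₂ h₂; cases h₂; exact ⟨rfl, rfl⟩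
  | seq hp hq ihp ihq =>
    intro s₂ σ₂ h₂
    cases h₂ with
    | seq hp' hq' =>
      obtain ⟨rfl, rfl⟩ := ihp hp'
      obtain ⟨rfl, rfl⟩ := ihq hq'
      exact ⟨rfl, rfl⟩
  | ite_true hi hp ihp =>
    intro s₂ σ₂ h₂
    cases h₂ with
    | ite_true _ hp' => obtain ⟨rfl, rfl⟩ := ihp hp'; exact ⟨rfl, rfl⟩
    | ite_false hi' _ => exact absurd hi' hi
  | ite_false hi hp ihp =>
    intro s₂ σ₂ h₂
    cases h₂ with
    | ite_false _ hp' => obtain ⟨rfl, rfl⟩ := ihp hp'; exact ⟨rfl, rfl⟩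
    | ite_true hi' _ => exact absurd hi hi'
  | loop_stop hi =>
    intro s₂ σ₂ h₂
    cases h₂ with
    | loop_stop => exact ⟨rfl, rfl⟩
    | loop_step hi' _ _ => exact absurd hi hi'
  | loop_step hi hp hl ihp ihl =>
    intro s₂ σ₂ h₂
    cases h₂ with
    | loop_stop hi' => exact absurd hi' hi
    | loop_step _ hp' hl' =>
      obtain ⟨rfl, rfl⟩ := ihp hp'
      obtain ⟨rfl, rfl⟩ := ihl hl'
      exact ⟨rfl, rfl⟩

namespace RamState

@[simp] theorem reg_setReg (σ : RamState) (i v j : ℕ) :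
    (σ.setReg i v).reg j = if j = i then v else σ.reg j := by
  simp [setReg, Function.update_apply]

@[simp] theorem arr_setReg (σ : RamState) (i v : ℕ) : (σ.setReg i v).arr = σ.arr := rfl

@[simp] theorem reg_setArr (σ : RamState) (a x v : ℕ) : (σ.setArr a x v).reg = σ.reg := rfl

@[simp] theorem arr_setArr (σ : RamState) (a x v b : ℕ) :
    (σ.setArr a x v).arr b = if b = a then Function.update (σ.arr a) x v else σ.arr b := by
  simp only [setArr, Function.update_apply]

/-- The memory `τ` holds a copy of `σ`, in the registers from `R` and the arrays from `A` on. -/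
structure Holds (R A : ℕ) (σ τ : RamState) : Prop where
  reg : ∀ i, τ.reg (i + R) = σ.reg i
  arr : ∀ a, τ.arr (a + A) = σ.arr a

/-- The memories `τ` and `τ'` agree on the registers below `R` and the arrays below `A`. -/
structure AgreeBelow (R A : ℕ) (τ τ' : RamState) : Prop where
  reg : ∀ i < R, τ'.reg i = τ.reg i
  arr : ∀ a < A, τ'.arr a = τ.arr a

theorem AgreeBelow.trans {R A : ℕ} {τ₁ τ₂ τ₃ : RamState} (h : AgreeBelow R A τ₁ τ₂)
    (h' : AgreeBelow R A τ₂ τ₃) : AgreeBelow R A τ₁ τ₃ :=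
  ⟨fun i hi => (h'.reg i hi).trans (h.reg i hi), fun a ha => (h'.arr a ha).trans (h.arr a ha)⟩

theorem AgreeBelow.refl (R A : ℕ) (τ : RamState) : AgreeBelow R A τ τ :=
  ⟨fun _ _ => rfl, fun _ _ => rfl⟩

theorem Holds.setReg {R A : ℕ} {σ τ : RamState} (h : Holds R A σ τ) (i v : ℕ) :
    Holds R A (σ.setReg i v) (τ.setReg (i + R) v) ∧
      AgreeBelow R A τ (τ.setReg (i + R) v) := by
  refine ⟨⟨fun j => ?_, fun a => by simp [h.arr]⟩, ⟨fun j hj => ?_, fun _ _ => rfl⟩⟩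
  · simp [h.reg]
  · simp only [reg_setReg, ite_eq_right_iff]; omega

theorem Holds.setArr {R A : ℕ} {σ τ : RamState} (h : Holds R A σ τ) (a x v : ℕ) :
    Holds R A (σ.setArr a x v) (τ.setArr (a + A) x v) ∧
      AgreeBelow R A τ (τ.setArr (a + A) x v) := by
  refine ⟨⟨fun j => by simp [h.reg], fun b => ?_⟩, ⟨fun _ _ => rfl, fun b hb => ?_⟩⟩
  · simp [h.arr]
  · simp only [arr_setArr, ite_eq_right_iff]; omega

end RamState

/-- The program with all registers moved up by `R` and all arrays by `A`. -/
def RamProg.shift (R A : ℕ) : RamProg → RamProg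
  | .const i c => .const (i + R) c
  | .add i j l => .add (i + R) (j + R) (l + R)
  | .sub i j l => .sub (i + R) (j + R) (l + R)
  | .load i a j => .load (i + R) (a + A) (j + R)
  | .store a i j => .store (a + A) (i + R) (j + R)
  | .seq p q => .seq (p.shift R A) (q.shift R A)
  | .ite i p q => .ite (i + R) (p.shift R A) (q.shift R A)
  | .loop i p => .loop (i + R) (p.shift R A)

/-- The relocated program touches only registers from `R` on and arrays from `A` on, so it simulates
the original step for step. `AgreeBelow` lets the surrounding program keep its own data meanwhile.
-/
theorem RamExec.shift (R A : ℕ) {p : RamProg} {σ σ' : RamState} {s : ℕ} (h : RamExec p σ s σ') :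
    ∀ τ : RamState, RamState.Holds R A σ τ → ∃ τ', RamExec (p.shift R A) τ s τ' ∧
      RamState.Holds R A σ' τ' ∧ RamState.AgreeBelow R A τ τ' := by
  induction h with
  | const i c σ => intro τ h; exact ⟨_, .const _ _ _, h.setReg i c⟩
  | add i j l σ =>
    intro τ h
    refine ⟨_, .add _ _ _ _, ?_⟩
    rw [h.reg, h.reg]
    exact h.setReg i _
  | sub i j l σ =>
    intro τ h
    refine ⟨_, .sub _ _ _ _, ?_⟩
    rw [h.reg, h.reg]
    exact h.setReg i _
  | load i a j σ =>
    intro τ h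
    refine ⟨_, .load _ _ _ _, ?_⟩
    rw [h.reg, h.arr]
    exact h.setReg i _
  | store a i j σ =>
    intro τ h
    refine ⟨_, .store _ _ _ _, ?_⟩
    rw [h.reg, h.reg]
    exact h.setArr a _ _
  | seq _ _ ihp ihq =>
    intro τ h
    obtain ⟨τ₁, e₁, h₁, b₁⟩ := ihp τ h
    obtain ⟨τ₂, e₂, h₂, b₂⟩ := ihq τ₁ h₁
    exact ⟨τ₂, .seq e₁ e₂, h₂, b₁.trans b₂⟩
  | ite_true hi _ ih =>
    intro τ h
    obtain ⟨τ₁, e₁, h₁, b₁⟩ := ih τ h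
    exact ⟨τ₁, .ite_true (by rwa [h.reg]) e₁, h₁, b₁⟩
  | ite_false hi _ ih =>
    intro τ h
    obtain ⟨τ₁, e₁, h₁, b₁⟩ := ih τ h
    exact ⟨τ₁, .ite_false (by rwa [h.reg]) e₁, h₁, b₁⟩
  | loop_stop hi =>
    intro τ h
    exact ⟨τ, RamExec.loop_stop (by rwa [h.reg]), h, .refl _ _ _⟩
  | loop_step hi _ _ ihp ihl =>
    intro τ h
    obtain ⟨τ₁, e₁, h₁, b₁⟩ := ihp τ h
    obtain ⟨τ₂, e₂, h₂, b₂⟩ := ihl τ₁ h₁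
    exact ⟨τ₂, .loop_step (by rwa [h.reg]) e₁ e₂, h₂, b₁.trans b₂⟩

/-! ### Rules for running times and postconditions of programs. -/

namespace RamProg

/-- Started in memory `σ`, the program halts after at most `T` steps, in a memory with the
property `Q`. -/
def Runs (p : RamProg) (σ : RamState) (T : ℕ) (Q : RamState → Prop) : Prop :=
  ∃ s ≤ T, ∃ σ', RamExec p σ s σ' ∧ Q σ'

variable {p q : RamProg} {σ : RamState} {T T₁ T₂ : ℕ} {Q Q' : RamState → Prop}

theorem Runs.mono (h : p.Runs σ T₁ Q) (hT : T₁ ≤ T) (hQ : ∀ τ, Q τ → Q' τ) : p.Runs σ T Q' := by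
  obtain ⟨s, hs, τ, e, hτ⟩ := h
  exact ⟨s, hs.trans hT, τ, e, hQ τ hτ⟩

theorem Runs.le (h : p.Runs σ T₁ Q) (hT : T₁ ≤ T) : p.Runs σ T Q := h.mono hT fun _ => id

/-- Weakest-precondition form: the postcondition of `p` is that `q` runs well. Chaining it executes
straight-line code symbolically; `Runs.seq` is the variant with an explicit intermediate assertion.
-/
theorem runs_seq (h : p.Runs σ T₁ fun τ => q.Runs τ T₂ Q) : (p.seq q).Runs σ (T₁ + T₂) Q := by
  obtain ⟨s, hs, τ, e, s', hs', τ', e', hQ⟩ := h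
  exact ⟨s + s', by omega, τ', .seq e e', hQ⟩

theorem Runs.seq {R : RamState → Prop} (h : p.Runs σ T₁ R) (h' : ∀ τ, R τ → q.Runs τ T₂ Q) :
    (p.seq q).Runs σ (T₁ + T₂) Q :=
  runs_seq (h.mono le_rfl h')

theorem runs_const {i c : ℕ} (h : Q (σ.setReg i c)) : (const i c).Runs σ 1 Q :=
  ⟨1, le_rfl, _, .const _ _ _, h⟩

theorem runs_add {i j l : ℕ} (h : Q (σ.setReg i (σ.reg j + σ.reg l))) :
    (add i j l).Runs σ 1 Q :=
  ⟨1, le_rfl, _, .add _ _ _ _, h⟩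

theorem runs_sub {i j l : ℕ} (h : Q (σ.setReg i (σ.reg j - σ.reg l))) :
    (sub i j l).Runs σ 1 Q :=
  ⟨1, le_rfl, _, .sub _ _ _ _, h⟩

theorem runs_load {i a j : ℕ} (h : Q (σ.setReg i (σ.arr a (σ.reg j)))) :
    (load i a j).Runs σ 1 Q :=
  ⟨1, le_rfl, _, .load _ _ _ _, h⟩

theorem runs_store {a i j : ℕ} (h : Q (σ.setArr a (σ.reg i) (σ.reg j))) :
    (store a i j).Runs σ 1 Q :=
  ⟨1, le_rfl, _, .store _ _ _ _, h⟩

theorem runs_ite {i : ℕ} (h : σ.reg i ≠ 0 → p.Runs σ T Q) (h' : σ.reg i = 0 → q.Runs σ T Q) :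
    (ite i p q).Runs σ (T + 1) Q := by
  by_cases hi : σ.reg i = 0
  · obtain ⟨s, hs, τ, e, hQ⟩ := h' hi
    exact ⟨s + 1, by omega, τ, .ite_false hi e, hQ⟩
  · obtain ⟨s, hs, τ, e, hQ⟩ := h hi
    exact ⟨s + 1, by omega, τ, .ite_true hi e, hQ⟩

/-- A loop that counts register `i` down from `m`. -/
theorem runs_loop {i m : ℕ} (inv : ℕ → RamState → Prop)
    (hinv : ∀ c ≤ m, ∀ τ, inv c τ → τ.reg i = m - c)
    (hbody : ∀ c < m, ∀ τ, inv c τ → p.Runs τ T (inv (c + 1))) (h : inv 0 σ) :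
    (loop i p).Runs σ (m * (T + 1) + 1) (inv m) := by
  suffices H : ∀ d c τ, c + d = m → inv c τ → (loop i p).Runs τ (d * (T + 1) + 1) (inv m) from
    H m 0 σ (by omega) h
  intro d
  induction d with
  | zero =>
    intro c τ hc hτ
    obtain rfl : c = m := by omega
    exact ⟨1, by omega, τ, RamExec.loop_stop (by rw [hinv c le_rfl τ hτ]; omega), hτ⟩
  | succ d ih =>
    intro c τ hc hτ
    obtain ⟨s, hs, τ₁, e, h₁⟩ := hbody c (by omega) τ hτ
    obtain ⟨s', hs', τ₂, e', h₂⟩ := ih (c + 1) τ₁ (by omega) h₁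
    refine ⟨s + s' + 1, ?_, τ₂, .loop_step (by rw [hinv c (by omega) τ hτ]; omega) e e', h₂⟩
    rw [Nat.succ_mul]; omega

/-- The programs `f 0, …, f (K-1)` one after the other. -/
def unroll (f : ℕ → RamProg) : ℕ → RamProg
  | 0 => const 0 0
  | K + 1 => seq (unroll f K) (f K)

/-- The empty composition is the dummy instruction `const 0 0`, hence the invariant is required
after register `0` has been cleared. -/
theorem runs_unroll {f : ℕ → RamProg} {K : ℕ} (inv : ℕ → RamState → Prop)
    (hskip : inv 0 (σ.setReg 0 0))
    (hbody : ∀ c < K, ∀ τ, inv c τ → (f c).Runs τ T (inv (c + 1))) :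
    (unroll f K).Runs σ (K * T + 1) (inv K) := by
  induction K with
  | zero => exact (runs_const hskip).le (by omega)
  | succ K ih =>
    refine ((ih fun c hc => hbody c (by omega)).seq (hbody K (by omega))).le ?_
    rw [Nat.succ_mul]; omega

/-- `x i := c * x j` for a constant `c`. -/
def mulConst (i j : ℕ) : ℕ → RamProg
  | 0 => const i 0
  | c + 1 => seq (mulConst i j c) (add i i j)

theorem runs_mulConst {i j c : ℕ} (hij : j ≠ i) (h : Q (σ.setReg i (c * σ.reg j))) :
    (mulConst i j c).Runs σ (c + 1) Q := by
  induction c generalizing Q with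
  | zero => exact runs_const (by simpa using h)
  | succ c ih =>
    refine runs_seq (ih (runs_add ?_))
    convert h using 1
    ext x y
    · by_cases hx : x = i <;> simp [hx, hij, Nat.succ_mul]
    · simp

/-- `x i := t[x j]` for a fixed table `t`; the register `j` is used up, the register `u` holds
`1`. -/
def lookup (i j u : ℕ) : List ℕ → RamProg
  | [] => const i 0
  | t :: ts => ite j (seq (sub j j u) (lookup i j u ts)) (const i t)

/-- Walking along the table decrements register `j`, so its final value is left arbitrary in the
hypothesis. -/
theorem runs_lookup {i j u : ℕ} {t : List ℕ} (hu : σ.reg u = 1) (huj : u ≠ j)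
    (h : ∀ v, Q ((σ.setReg j v).setReg i (t.getD (σ.reg j) 0))) :
    (lookup i j u t).Runs σ (2 * t.length + 1) Q := by
  have hself : ∀ τ : RamState, τ.setReg j (τ.reg j) = τ := fun τ => by
    ext x y
    · by_cases hx : x = j <;> simp [hx]
    · simp
  induction t generalizing σ with
  | nil =>
    refine runs_const ?_
    simpa [hself] using h (σ.reg j)
  | cons a t ih =>
    refine (runs_ite (T := 1 + (2 * t.length + 1)) (fun hj => runs_seq (runs_sub ?_)) fun hj =>
      (runs_const ?_).le (by omega)).le (by simp; omega)
    · refine ih (by simp [hu, huj]) fun v => ?_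
      convert h v using 1
      obtain ⟨r, hr⟩ := Nat.exists_eq_succ_of_ne_zero hj
      ext x y
      · by_cases hx : x = i <;> by_cases hx' : x = j <;> simp [hx, hx', hu, hr]
      · simp
    · have := h (σ.reg j)
      rw [hself] at this
      simpa [hj] using this

theorem Runs.shift {p : RamProg} (R A : ℕ) {σ τ : RamState} {T : ℕ} {Q : RamState → Prop}
    (h : p.Runs σ T Q) (hτ : RamState.Holds R A σ τ) :
    (p.shift R A).Runs τ T fun τ' =>
      ∃ σ', Q σ' ∧ RamState.Holds R A σ' τ' ∧ RamState.AgreeBelow R A τ τ' := by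
  obtain ⟨s, hs, σ', e, hQ⟩ := h
  obtain ⟨τ', e', h', b'⟩ := e.shift R A τ hτ
  exact ⟨s, hs, τ', e', σ', hQ, h', b'⟩

theorem Runs.haltsWithin {w : List ℕ} (h : p.Runs (RamState.initial w) T Q) :
    p.HaltsWithin w T := by
  obtain ⟨s, hs, τ, e, -⟩ := h
  exact ⟨s, hs, τ, e⟩

theorem Runs.accepts {w : List ℕ} (h : p.Runs (RamState.initial w) T fun τ => τ.reg 0 ≠ 0) :
    p.Accepts w := by
  obtain ⟨s, hs, τ, e, h⟩ := h
  exact ⟨τ, ⟨s, e⟩, h⟩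

theorem Runs.rejects {w : List ℕ} (h : p.Runs (RamState.initial w) T fun τ => τ.reg 0 = 0) :
    p.Rejects w := by
  obtain ⟨s, hs, τ, e, h⟩ := h
  exact ⟨τ, ⟨s, e⟩, h⟩

theorem Rejects.not_accepts {w : List ℕ} (h : p.Rejects w) : ¬ p.Accepts w := by
  rintro ⟨τ, ⟨s, e⟩, hτ⟩
  obtain ⟨τ', ⟨s', e'⟩, hτ'⟩ := h
  obtain ⟨-, rfl⟩ := e.deterministic e'
  exact hτ hτ'

/-- The time bound of `HaltsWithin` holds for every halting computation. -/
theorem HaltsWithin.runs {w : List ℕ} (h : p.HaltsWithin w T) (hw : p.HaltsWith w σ) :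
    p.Runs (RamState.initial w) T (· = σ) := by
  obtain ⟨s, hs, τ, e⟩ := h
  obtain ⟨s', e'⟩ := hw
  obtain ⟨-, rfl⟩ := e.deterministic e'
  exact ⟨s, hs, τ, e, rfl⟩

end RamProg

/-- Memory beyond the end of a list reads as 0, so storing at the first free address appends a word.
-/
theorem List.update_getD_length (l : List ℕ) (v : ℕ) :
    Function.update (fun x => l.getD x 0) l.length v = fun x => (l ++ [v]).getD x 0 := by
  funext x
  rcases lt_trichotomy x l.length with h | rfl | h
  · simp [Function.update_of_ne h.ne, List.getElem?_append_left h]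
  · simp
  · rw [Function.update_of_ne h.ne']
    simp [List.getElem?_eq_none h.le,
      List.getElem?_eq_none (l := l ++ [v]) (i := x) (by simp; omega)]

/-! ## The program that turns an instance into a pair of graphs -/

namespace RamProg

/-- The memory while a pair of graphs is written: `w` is the input, `out` the output so far, `c`
the loop counter, `p` the address of the current constraint, `v` the number of the current
constraint vertex. -/
structure BuildState (w out : List ℕ) (n m c p v : ℕ) (τ : RamState) : Prop where
  one : τ.reg 1 = 1
  count : τ.reg 2 = c
  ptr : τ.reg 3 = p
  vert : τ.reg 4 = v
  len : τ.reg 5 = out.length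
  vars : τ.reg 6 = n
  cons : τ.reg 7 = m
  input : τ.arr 0 = fun x => w.getD x 0
  output : τ.arr 1 = fun x => out.getD x 0
  high_reg : ∀ i, 12 ≤ i → τ.reg i = 0
  high_arr : ∀ a, 2 ≤ a → τ.arr a = fun _ => 0

variable {w out : List ℕ} {n m c p v : ℕ} {σ : RamState}

theorem BuildState.setReg_zero (h : BuildState w out n m c p v σ) (x : ℕ) :
    BuildState w out n m c p v (σ.setReg 0 x) := by
  obtain ⟨h1, h2, h3, h4, h5, h6, h7, h8, h9, h10, h11⟩ := h
  refine ⟨by simpa, by simpa, by simpa, by simpa, by simpa, by simpa, by simpa, by simpa, by simpa,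
    fun i hi => ?_, by simpa⟩
  simp [h10 i hi, show i ≠ 0 by omega]

theorem BuildState.setReg_temp (h : BuildState w out n m c p v σ) {i : ℕ} (h₁ : 8 ≤ i)
    (h₂ : i < 12) (x : ℕ) : BuildState w out n m c p v (σ.setReg i x) := by
  obtain ⟨h1, h2, h3, h4, h5, h6, h7, h8, h9, h10, h11⟩ := h
  constructor <;> try simp only [RamState.reg_setReg, RamState.arr_setReg]
  all_goals try (rw [if_neg (by omega)]; assumption)
  all_goals try assumption
  intro j hj
  rw [if_neg (by omega), h10 j hj]

theorem BuildState.setReg_count (h : BuildState w out n m c p v σ) (x : ℕ) :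
    BuildState w out n m x p v (σ.setReg 2 x) := by
  obtain ⟨h1, h2, h3, h4, h5, h6, h7, h8, h9, h10, h11⟩ := h
  refine ⟨by simpa, by simp, by simpa, by simpa, by simpa, by simpa, by simpa, by simpa, by simpa,
    fun i hi => ?_, by simpa⟩
  simp [h10 i hi, show i ≠ 2 by omega]

theorem BuildState.setReg_ptr (h : BuildState w out n m c p v σ) (x : ℕ) :
    BuildState w out n m c x v (σ.setReg 3 x) := by
  obtain ⟨h1, h2, h3, h4, h5, h6, h7, h8, h9, h10, h11⟩ := h
  refine ⟨by simpa, by simpa, by simp, by simpa, by simpa, by simpa, by simpa, by simpa, by simpa,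
    fun i hi => ?_, by simpa⟩
  simp [h10 i hi, show i ≠ 3 by omega]

theorem BuildState.setReg_vert (h : BuildState w out n m c p v σ) (x : ℕ) :
    BuildState w out n m c p x (σ.setReg 4 x) := by
  obtain ⟨h1, h2, h3, h4, h5, h6, h7, h8, h9, h10, h11⟩ := h
  refine ⟨by simpa, by simpa, by simpa, by simp, by simpa, by simpa, by simpa, by simpa, by simpa,
    fun i hi => ?_, by simpa⟩
  simp [h10 i hi, show i ≠ 4 by omega]

/-- Append the contents of register `r` to the output. -/
def emit (r : ℕ) : RamProg :=
  seq (store 1 5 r) (add 5 5 1)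

theorem runs_emit (h : BuildState w out n m c p v σ) (r : ℕ) :
    (emit r).Runs σ 2 fun τ =>
      BuildState w (out ++ [σ.reg r]) n m c p v τ ∧ ∀ i, i ≠ 5 → τ.reg i = σ.reg i := by
  refine runs_seq (runs_store (runs_add ⟨?_, fun i hi => by simp [hi]⟩))
  obtain ⟨h1, h2, h3, h4, h5, h6, h7, h8, h9, h10, h11⟩ := h
  refine ⟨by simpa, by simpa, by simpa, by simpa, by simp [h5, h1], by simpa, by simpa, by simpa,
    ?_, fun i hi => ?_, fun a ha => ?_⟩
  · simp only [RamState.arr_setReg, RamState.arr_setArr, if_true, h5, h9]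
    exact List.update_getD_length _ _
  · simp [h10 i hi, show i ≠ 5 by omega]
  · simp [h11 a ha, show a ≠ 1 by omega]

/-- Write the edge of the current constraint vertex that belongs to coordinate `l`.  The table `t`
gives the value of the variable vertex as a function of the group element of the constraint. -/
def edgeProg (d k l : ℕ) (t : List ℕ) : RamProg :=
  seq (const 8 l) <| seq (add 8 3 8) <| seq (load 8 0 8) <| seq (mulConst 9 8 d) <|
  seq (const 10 (k + l)) <| seq (add 10 3 10) <| seq (load 10 0 10) <| seq (lookup 11 10 1 t) <|
  seq (add 9 9 11) <| seq (emit 4) (emit 9)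

theorem runs_edgeProg (h : BuildState w out n m c p v σ) (d k l : ℕ) (t : List ℕ) :
    (edgeProg d k l t).Runs σ (d + 2 * t.length + 13)
      (BuildState w (out ++ [v, d * w.getD (p + l) 0 + t.getD (w.getD (p + k + l) 0) 0])
        n m c p v) := by
  refine Runs.le (T₁ := 1 + (1 + (1 + ((d + 1) + (1 + (1 + (1 + ((2 * t.length + 1) +
    (1 + (2 + 2)))))))))) ?_ (by omega)
  refine runs_seq <| runs_const <| runs_seq <| runs_add <| runs_seq <| runs_load <|
    runs_seq <| runs_mulConst (by decide) <| runs_seq <| runs_const <| runs_seq <| runs_add <|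
    runs_seq <| runs_load <| runs_seq <| runs_lookup (by simp [h.one]) (by decide) fun x =>
    runs_seq <| runs_add <| runs_seq ?_
  refine (runs_emit (w := w) (out := out) (n := n) (m := m) (c := c) (p := p) (v := v) ?_ 4).mono
    le_rfl fun τ hτ => (runs_emit hτ.1 9).mono le_rfl fun τ' hτ' => ?_
  · repeat refine BuildState.setReg_temp ?_ (by omega) (by omega) _
    exact h
  · have := hτ'.1
    rw [hτ.2 9 (by decide)] at this
    simpa [h.vert, h.ptr, h.input, Nat.add_assoc] using this

/-- Write all edges of the vertices of one constraint: `s` vertices of degree `k`. -/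
def constraintProg (d k s : ℕ) (t : ℕ → ℕ → List ℕ) : RamProg :=
  unroll (fun q => seq (unroll (fun l => edgeProg d k l (t q l)) k) (add 4 4 1)) s

/-- The words that `constraintProg` writes. -/
def constraintEdges (w : List ℕ) (d k s : ℕ) (t : ℕ → ℕ → List ℕ) (p v : ℕ) : List ℕ :=
  (List.range s).flatMap fun q => (List.range k).flatMap fun l =>
    [v + q, d * w.getD (p + l) 0 + (t q l).getD (w.getD (p + k + l) 0) 0]

theorem runs_constraintProg (h : BuildState w out n m c p v σ) (d k s : ℕ) {t : ℕ → ℕ → List ℕ}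
    (ht : ∀ q l, (t q l).length = d) :
    (constraintProg d k s t).Runs σ (s * (k * (d + 2 * d + 13) + 1 + 1) + 1)
      (BuildState w (out ++ constraintEdges w d k s t p v) n m c p (v + s)) := by
  refine runs_unroll (fun q => BuildState w (out ++ constraintEdges w d k q t p v) n m c p (v + q))
    (by simpa [constraintEdges] using h.setReg_zero 0) fun q _ τ hτ => ?_
  refine Runs.seq (R := BuildState w (out ++ constraintEdges w d k (q + 1) t p v) n m c p (v + q))
    ?_ fun τ' hτ' => runs_add ?_
  · refine (runs_unroll (fun l => BuildState w (out ++ constraintEdges w d k q t p v ++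
      (List.range l).flatMap fun l =>
        [v + q, d * w.getD (p + l) 0 + (t q l).getD (w.getD (p + k + l) 0) 0])
        n m c p (v + q)) (by simpa using hτ.setReg_zero 0) fun l _ τ' hτ' => ?_).mono le_rfl
        fun τ' hτ' => ?_
    · refine (runs_edgeProg hτ' d k l (t q l)).mono (by rw [ht]) fun τ'' h'' => ?_
      simpa [List.range_succ] using h''
    · simpa [constraintEdges, List.range_succ] using hτ'
  · have := hτ'.setReg_vert (τ'.reg 4 + τ'.reg 1)
    simpa only [hτ'.vert, hτ'.one, Nat.add_assoc] using this

/-- Write the edges of the vertices of all constraints. -/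
def passProg (d k s : ℕ) (t : ℕ → ℕ → List ℕ) : RamProg :=
  seq (mulConst 4 6 d) <| seq (const 3 2) <| seq (const 0 0) <| seq (add 2 7 0) <|
    loop 2 <| seq (constraintProg d k s t) <| seq (const 8 (k + k)) <| seq (add 3 3 8) (sub 2 2 1)

/-- The words that `passProg` writes. -/
def passEdges (w : List ℕ) (n m d k s : ℕ) (t : ℕ → ℕ → List ℕ) : List ℕ :=
  (List.range m).flatMap fun c => constraintEdges w d k s t (2 + (k + k) * c) (d * n + s * c)

theorem runs_passProg (h : BuildState w out n m c p v σ) (d k s : ℕ) {t : ℕ → ℕ → List ℕ}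
    (ht : ∀ q l, (t q l).length = d) :
    (passProg d k s t).Runs σ (m * (s * (k * (d + 2 * d + 13) + 1 + 1) + 1 + 3 + 1) + d + 5)
      fun τ => ∃ p v, BuildState w (out ++ passEdges w n m d k s t) n m 0 p v τ := by
  refine Runs.le (T₁ := (d + 1) + (1 + (1 + (1 +
    (m * (s * (k * (d + 2 * d + 13) + 1 + 1) + 1 + (1 + (1 + 1)) + 1) + 1)))))
    ?_ (by rw [show 1 + (1 + 1) = 3 from rfl]; omega)
  refine runs_seq <| runs_mulConst (by decide) <| runs_seq <| runs_const <| runs_seq <|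
    runs_const <| runs_seq <| runs_add ?_
  -- Two header words precede the constraints, each of which takes 2k words; the vertices of
  -- constraint `c` are numbered from d·n + s·c on, after all variable vertices and those of earlier
  -- constraints.
  refine (runs_loop (fun c τ => BuildState w (out ++ (List.range c).flatMap fun c =>
    constraintEdges w d k s t (2 + (k + k) * c) (d * n + s * c)) n m (m - c) (2 + (k + k) * c)
      (d * n + s * c) τ) (fun c _ τ hτ => hτ.count) (fun c hc τ hτ => ?_) ?_).mono le_rfl
      fun τ hτ => ⟨_, _, by simpa [passEdges] using hτ⟩
  · refine (runs_constraintProg hτ d k s ht).seq fun τ₁ h₁ => runs_seq <| runs_const <|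
      runs_seq <| runs_add <| runs_sub ?_
    have := ((h₁.setReg_temp (le_refl 8) (by decide) (k + k)).setReg_ptr
      (2 + (k + k) * (c + 1))).setReg_count (m - (c + 1))
    have e : m - (c + 1) = m - c - 1 := by omega
    simpa [h₁.ptr, h₁.count, h₁.one, List.range_succ, Nat.mul_succ, Nat.add_assoc, e] using this
  · have := (((h.setReg_vert (d * n)).setReg_ptr 2).setReg_zero 0).setReg_count m
    simpa [h.vars, h.cons] using this

/-- The output of `buildProg`. -/
def buildWords (w : List ℕ) (n m d k s : ℕ) (t t' : ℕ → ℕ → List ℕ) : List ℕ :=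
  (d * n + s * m) :: (k * s * m) :: (k * s * m) ::
    (passEdges w n m d k s t ++ passEdges w n m d k s t')

/-- Write a pair of graphs. -/
def buildProg (d k s : ℕ) (t t' : ℕ → ℕ → List ℕ) : RamProg :=
  seq (const 1 1) <| seq (load 6 0 0) <| seq (load 7 0 1) <| seq (mulConst 8 6 d) <|
  seq (mulConst 9 7 s) <| seq (add 8 8 9) <| seq (mulConst 9 7 (k * s)) <| seq (emit 8) <|
  seq (emit 9) <| seq (emit 9) <| seq (passProg d k s t) (passProg d k s t')

theorem runs_buildProg (w : List ℕ) (n m d k s : ℕ) {t t' : ℕ → ℕ → List ℕ}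
    (ht : ∀ q l, (t q l).length = d) (ht' : ∀ q l, (t' q l).length = d) :
    (buildProg d k s t t').Runs (RamState.initial (n :: m :: w))
      (2 * (m * (s * (k * (d + 2 * d + 13) + 1 + 1) + 1 + 3 + 1) + d + 5) +
        (d + s + k * s + 13))
      fun τ => ∃ c p v,
        BuildState (n :: m :: w) (buildWords (n :: m :: w) n m d k s t t') n m c p v τ := by
  refine Runs.le (T₁ := 1 + (1 + (1 + ((d + 1) + ((s + 1) + (1 + ((k * s + 1) + (2 + (2 + (2 +
    ((m * (s * (k * (d + 2 * d + 13) + 1 + 1) + 1 + 3 + 1) + d + 5) +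
    (m * (s * (k * (d + 2 * d + 13) + 1 + 1) + 1 + 3 + 1) + d + 5)))))))))))) ?_ (by omega)
  refine runs_seq <| runs_const <| runs_seq <| runs_load <| runs_seq <| runs_load <|
    runs_seq <| runs_mulConst (by decide) <| runs_seq <| runs_mulConst (by decide) <|
    runs_seq <| runs_add <| runs_seq <| runs_mulConst (by decide) ?_
  refine Runs.seq (T₁ := 2) (R := fun τ => BuildState (n :: m :: w) [d * n + s * m] n m 0 0 0 τ ∧
    τ.reg 9 = k * s * m) ?_ fun τ₁ ⟨h₁, e₁⟩ => ?_
  · refine (runs_emit (w := n :: m :: w) (out := []) (n := n) (m := m) (c := 0) (p := 0)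
      (v := 0) ?_ 8).mono le_rfl fun τ h => ⟨by simpa [RamState.initial] using h.1,
        by simp [h.2, RamState.initial]⟩
    constructor <;> simp [RamState.initial]
    · intro i hi
      simp [show i ≠ 9 by omega, show i ≠ 8 by omega, show i ≠ 7 by omega, show i ≠ 6 by omega,
        show i ≠ 1 by omega]
    · intro a ha
      simp [show a ≠ 0 by omega]
  refine (runs_emit h₁ 9).seq fun τ₂ ⟨h₂, e₂⟩ => (runs_emit h₂ 9).seq fun τ₃ ⟨h₃, _⟩ =>
    (runs_passProg h₃ d k s ht).seq fun τ₄ ⟨p₄, v₄, h₄⟩ =>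
    (runs_passProg h₄ d k s ht').mono le_rfl fun τ₅ ⟨p₅, v₅, h₅⟩ => ⟨0, p₅, v₅, ?_⟩
  rw [e₂ 9 (by decide), e₁] at h₅
  simpa [buildWords] using h₅

/-- Write the pair of graphs, run `P` on it, and answer the opposite. -/
def reductionProg (P : RamProg) (d k s : ℕ) (t t' : ℕ → ℕ → List ℕ) : RamProg :=
  seq (buildProg d k s t t') <| seq (P.shift 12 1) (ite 12 (const 0 0) (const 0 1))

theorem runs_reductionProg {P : RamProg} (w : List ℕ) (n m d k s : ℕ) {t t' : ℕ → ℕ → List ℕ}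
    (ht : ∀ q l, (t q l).length = d) (ht' : ∀ q l, (t' q l).length = d) {T : ℕ} {σ : RamState}
    (hP : P.HaltsWithin (buildWords (n :: m :: w) n m d k s t t') T)
    (hσ : P.HaltsWith (buildWords (n :: m :: w) n m d k s t t') σ) :
    (reductionProg P d k s t t').Runs (RamState.initial (n :: m :: w))
      (2 * (m * (s * (k * (d + 2 * d + 13) + 1 + 1) + 1 + 3 + 1) + d + 5) +
        (d + s + k * s + 13) + (T + 2))
      fun τ => τ.reg 0 = if σ.reg 0 = 0 then 1 else 0 := by
  refine (runs_buildProg w n m d k s ht ht').seq fun τ ⟨c, p, v, h⟩ => ?_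
  -- Registers from 12 and arrays from 2 on are still zero, and array 1 holds the words just
  -- written. Seen through the shift this is exactly an initial memory whose input is the pair of
  -- graphs.
  refine ((hP.runs hσ).shift 12 1 ⟨fun i => ?_, fun a => ?_⟩).seq (T₂ := 2)
    fun τ₁ ⟨σ', hσ', h₁, _⟩ => runs_ite (T := 1) (fun h => runs_const ?_) fun h => runs_const ?_
  · simpa [RamState.initial] using h.high_reg (i + 12) (by omega)
  · rcases a with - | a
    · simpa [RamState.initial] using h.output
    · simpa [RamState.initial] using h.high_arr (a + 1 + 1) (by omega)
  · subst hσ'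
    have := h₁.reg 0
    simp only [Nat.zero_add] at this
    rw [this] at h
    simp [h]
  · subst hσ'
    have := h₁.reg 0
    simp only [Nat.zero_add] at this
    rw [this] at h
    simp [h]

end RamProg

/-! ## The pair of graphs of an instance -/

theorem List.getD_flatMap_of_length {α : Type*} {g : α → List ℕ} {L : ℕ}
    (hg : ∀ a, (g a).length = L) (l : List α) {c : ℕ} (hc : c < l.length) {i : ℕ} (hi : i < L) :
    (l.flatMap g).getD (L * c + i) 0 = (g l[c]).getD i 0 := by
  induction l generalizing c with
  | nil => simp at hc
  | cons a l ih =>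
    rcases c with - | c
    · simp [List.getElem?_append_left (show i < (g a).length by rw [hg]; exact hi)]
    · have := ih (c := c) (by simpa using hc)
      rw [List.flatMap_cons, List.getD_append_right _ _ _ _ (by rw [hg, Nat.mul_succ]; omega), hg,
        show L * (c + 1) + i - L = L * c + i by rw [Nat.mul_succ]; omega, this]
      simp

section Words

variable {H : Type*} [Fintype H] {k n m : ℕ}

theorem length_constraintWords (c : AdditiveConstraint k H n) :
    (constraintWords c).length = k + k := by
  simp [constraintWords]

theorem getD_instanceWords (C : AdditiveInstance k H n m) (c : Fin m) {i : ℕ} (hi : i < k + k) :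
    (instanceWords C).getD (2 + (k + k) * c + i) 0 = (constraintWords (C c)).getD i 0 := by
  have := List.getD_flatMap_of_length (g := constraintWords (k := k) (H := H) (n := n))
    length_constraintWords (List.ofFn C) (c := c) (by simp) hi
  rw [instanceWords, show 2 + (k + k) * (c : ℕ) + i = (k + k) * c + i + 1 + 1 by omega,
    List.getD_cons_succ, List.getD_cons_succ, this]
  simp

theorem getD_instanceWords_var (C : AdditiveInstance k H n m) (c : Fin m) (l : Fin k) :
    (instanceWords C).getD (2 + (k + k) * c + l) 0 = (C c).1 l := by
  rw [getD_instanceWords C c (by omega), constraintWords, List.getD_append _ _ _ _ (by simp)]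
  simp

theorem getD_instanceWords_shift (C : AdditiveInstance k H n m) (c : Fin m) (l : Fin k) :
    (instanceWords C).getD (2 + (k + k) * c + k + l) 0 = Fintype.equivFin H ((C c).2 l) := by
  rw [Nat.add_assoc, getD_instanceWords C c (by omega), constraintWords,
    List.getD_append_right _ _ _ _ (by simp)]
  simp

end Words

section Gadget

variable {H : Type*} [AddCommGroup H] {k n m d s : ℕ} {S : AddSubgroup (Fin k → H)}

/-- The vertices: a pair of a variable and a group element, or a pair of a constraint and an
element of the subgroup. -/
abbrev GadgetVertex (S : AddSubgroup (Fin k → H)) (n m : ℕ) : Type _ := (Fin n × H) ⊕ (Fin m × S)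

/-- The numbering of the vertices. -/
def vertexNum (eH : H ≃ Fin d) (eS : S ≃ Fin s) (n m : ℕ) :
    GadgetVertex S n m ≃ Fin (n * d + m * s) :=
  (Equiv.sumCongr (((Equiv.refl _).prodCongr eH).trans finProdFinEquiv)
    (((Equiv.refl _).prodCongr eS).trans finProdFinEquiv)).trans finSumFinEquiv

theorem vertexNum_inl (eH : H ≃ Fin d) (eS : S ≃ Fin s) (i : Fin n) (h : H) :
    (vertexNum eH eS n m (.inl (i, h)) : ℕ) = d * i + eH h := by
  simp [vertexNum, Nat.add_comm]

theorem vertexNum_inr (eH : H ≃ Fin d) (eS : S ≃ Fin s) (c : Fin m) (t : S) :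
    (vertexNum eH eS n m (.inr (c, t)) : ℕ) = d * n + s * c + eS t := by
  simp [vertexNum, Nat.mul_comm n d]; omega

/-- The edges are labelled by a constraint, an element of the subgroup, and a coordinate.  This is
the end on the side of the variables. -/
def varEnd (C : AdditiveInstance k H n m) (x : Fin m × S × Fin k) : Fin n × H :=
  ((C x.1).1 x.2.2, x.2.1.1 x.2.2 - (C x.1).2 x.2.2)

/-- The edge with the given label. -/
def gadgetEdge (v : GadgetVertex S n m ≃ Fin (n * d + m * s)) (C : AdditiveInstance k H n m)
    (x : Fin m × S × Fin k) : Sym2 (Fin (n * d + m * s)) :=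
  s(v (.inr (x.1, x.2.1)), v (.inl (varEnd C x)))

/-- The graph of an instance. -/
def gadgetGraph (v : GadgetVertex S n m ≃ Fin (n * d + m * s)) (C : AdditiveInstance k H n m) :
    SimpleGraph (Fin (n * d + m * s)) :=
  .fromEdgeSet (Set.range (gadgetEdge v C))

/-- The instance with all shifts replaced by `0`. -/
def homogeneous (C : AdditiveInstance k H n m) : AdditiveInstance k H n m := fun c => ((C c).1, 0)

variable (v : GadgetVertex S n m ≃ Fin (n * d + m * s)) (C : AdditiveInstance k H n m)

theorem edgeSet_gadgetGraph : (gadgetGraph v C).edgeSet = Set.range (gadgetEdge v C) := by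
  rw [gadgetGraph, SimpleGraph.edgeSet_fromEdgeSet, sdiff_eq_left, Set.disjoint_left]
  rintro _ ⟨x, rfl⟩
  simp [gadgetEdge]

/-- The constraint end of an edge gives `c` and `t`; the variable end gives the coordinate because
the indices of a constraint are distinct. -/
theorem gadgetEdge_injective : Function.Injective (gadgetEdge v C) := by
  rintro ⟨c, t, l⟩ ⟨c', t', l'⟩ h
  simp only [gadgetEdge, varEnd, Sym2.eq_iff, EmbeddingLike.apply_eq_iff_eq, Sum.inr.injEq,
    Sum.inl.injEq, Prod.mk.injEq, reduceCtorEq, and_self, or_false] at h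
  obtain ⟨⟨rfl, rfl⟩, h, -⟩ := h
  rw [(C c).1.injective h]

theorem ncard_edgeSet_gadgetGraph (eS : S ≃ Fin s) :
    (gadgetGraph v C).edgeSet.ncard = m * (s * k) := by
  rw [edgeSet_gadgetGraph, ← Set.image_univ, Set.ncard_image_of_injective _
    (gadgetEdge_injective v C), Set.ncard_univ]
  simp [Nat.card_congr eS]

/-- The labels of the edges in the order in which the program writes them. -/
def edgeLabels (eS : S ≃ Fin s) (m : ℕ) : List (Fin m × S × Fin k) :=
  List.finRange m ×ˢ ((List.finRange s).map eS.symm ×ˢ List.finRange k)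

theorem isEdgeListing_gadgetGraph (eS : S ≃ Fin s) :
    IsEdgeListing (gadgetGraph v C) ((edgeLabels eS m).map fun x =>
      (v (.inr (x.1, x.2.1)), v (.inl (varEnd C x)))) := by
  refine ⟨?_, fun e => ?_⟩
  · rw [List.map_map]
    refine List.Nodup.map (gadgetEdge_injective v C) ?_
    exact (List.nodup_finRange m).product
      (((List.nodup_finRange s).map eS.symm.injective).product (List.nodup_finRange k))
  · rw [List.map_map, edgeSet_gadgetGraph, List.mem_map, Set.mem_range]
    refine exists_congr fun x => ?_
    have : x ∈ edgeLabels eS m := by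
      obtain ⟨c, t, l⟩ := x
      simp [edgeLabels, eS.symm.surjective t]
    simp only [this, true_and]
    rfl

/-- The tables by which the program finds the ends of the edges. -/
def edgeTable (f : Fin s → Fin k → Fin d → Fin d) (q l : ℕ) : List ℕ :=
  List.ofFn fun a => if h : q < s ∧ l < k then (f ⟨q, h.1⟩ ⟨l, h.2⟩ a : ℕ) else 0

theorem flatMap_range {α : Type*} (f : ℕ → List α) (N : ℕ) :
    (List.range N).flatMap f = (List.finRange N).flatMap fun i : Fin N => f i := by
  rw [← List.map_coe_finRange_eq_range, List.flatMap_map]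

/-- Both graphs are written from the words of the one instance `C`: only the table `f` differs, so
`C'` may be `C` itself or its homogeneous version. -/
theorem passEdges_eq [Fintype H] (eS : S ≃ Fin s) (C C' : AdditiveInstance k H n m)
    (f : Fin s → Fin k → Fin (Fintype.card H) → Fin (Fintype.card H))
    (h₁ : ∀ c, (C' c).1 = (C c).1)
    (h₂ : ∀ c q l, Fintype.equivFin H ((eS.symm q).1 l - (C' c).2 l) =
      f q l (Fintype.equivFin H ((C c).2 l))) :
    RamProg.passEdges (instanceWords C) n m (Fintype.card H) k s (edgeTable f) =
      edgeWords ((edgeLabels eS m).map fun x =>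
        (vertexNum (Fintype.equivFin H) eS n m (.inr (x.1, x.2.1)),
          vertexNum (Fintype.equivFin H) eS n m (.inl (varEnd C' x)))) := by
  simp only [RamProg.passEdges, RamProg.constraintEdges, flatMap_range, edgeWords, edgeLabels,
    SProd.sprod, List.product, List.flatMap_map, List.flatMap_assoc, List.map_flatMap, List.map_map]
  congr! 6 with c q l
  have h := h₂ c q l
  simp only [vertexNum_inr, vertexNum_inl, varEnd, h₁, h, getD_instanceWords_var,
    getD_instanceWords_shift, Equiv.apply_symm_apply, Function.comp]
  simp [edgeTable]

theorem isPairEncoding_gadgetGraph [Fintype H] (eS : S ≃ Fin s) (C : AdditiveInstance k H n m) :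
    IsPairEncoding (gadgetGraph (vertexNum (Fintype.equivFin H) eS n m) C)
      (gadgetGraph (vertexNum (Fintype.equivFin H) eS n m) (homogeneous C))
      (RamProg.buildWords (instanceWords C) n m (Fintype.card H) k s
        (edgeTable fun q l a => Fintype.equivFin H
          ((eS.symm q).1 l - (Fintype.equivFin H).symm a))
        (edgeTable fun q l _ => Fintype.equivFin H ((eS.symm q).1 l))) := by
  refine ⟨_, _, isEdgeListing_gadgetGraph _ C eS, isEdgeListing_gadgetGraph _ _ eS, ?_⟩
  have hlen : (edgeLabels eS m).length = k * s * m := by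
    simp only [edgeLabels, List.length_product, List.length_finRange, List.length_map]
    ring
  rw [RamProg.buildWords, passEdges_eq eS C C _ (fun _ => rfl) (by simp),
    passEdges_eq eS C (homogeneous C) _ (fun _ => rfl) (by simp [homogeneous]),
    List.length_map, List.length_map, hlen]
  congr 1
  ring

/-! ### Approximate isomorphisms between the two graphs. -/

/-- The number of labels whose edges `π` maps to edges. -/
theorem ncard_preserved (C' : AdditiveInstance k H n m)
    (π : Fin (n * d + m * s) ≃ Fin (n * d + m * s)) :
    {e ∈ (gadgetGraph v C).edgeSet | e.map π ∈ (gadgetGraph v C').edgeSet}.ncard =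
      {x | (gadgetEdge v C x).map π ∈ Set.range (gadgetEdge v C')}.ncard := by
  rw [← Set.ncard_image_of_injective _ (gadgetEdge_injective v C)]
  congr 1
  ext e
  simp only [edgeSet_gadgetGraph, Set.mem_ofPred_eq, Set.mem_range, Set.mem_image]
  constructor
  · rintro ⟨⟨x, rfl⟩, h⟩
    exact ⟨x, h, rfl⟩
  · rintro ⟨x, h, rfl⟩
    exact ⟨⟨x, rfl⟩, h⟩

/-- Both graphs have m·s·k edges. The bound `α ≤ 1` covers the case without edges, where the value
is 1 by convention. -/
theorem isApproxIso_gadgetGraph_iff (eS : S ≃ Fin s) (C' : AdditiveInstance k H n m)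
    (π : Fin (n * d + m * s) ≃ Fin (n * d + m * s)) {α : ℝ} (hα : α ≤ 1) :
    IsApproxIso α (gadgetGraph v C) (gadgetGraph v C') π ↔ α * (m * (s * k) : ℕ) ≤
      ({x | (gadgetEdge v C x).map π ∈ Set.range (gadgetEdge v C')}.ncard : ℝ) := by
  rw [IsApproxIso, graphIsoValue, ncard_edgeSet_gadgetGraph v C eS,
    ncard_edgeSet_gadgetGraph v C' eS, max_self, ncard_preserved]
  split_ifs with h
  · rw [h]
    simpa using hα
  · rw [le_div_iff₀ (by exact_mod_cast Nat.pos_of_ne_zero h)]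

open Classical in
/-- The element of the subgroup that an assignment picks in a satisfied constraint. -/
noncomputable def pickedElement (S : AddSubgroup (Fin k → H)) (C : AdditiveInstance k H n m)
    (τ : Fin n → H) (c : Fin m) : S :=
  if h : ConstraintSatisfied (S : Set (Fin k → H)) (C c) τ then ⟨_, h⟩ else 0

/-- The bijection of the vertices that an assignment induces. -/
noncomputable def assignmentEquiv (C : AdditiveInstance k H n m) (τ : Fin n → H) :
    GadgetVertex S n m ≃ GadgetVertex S n m :=
  Equiv.sumCongr (Equiv.prodShear (Equiv.refl _) fun i => Equiv.subRight (τ i))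
    (Equiv.prodShear (Equiv.refl _) fun c => Equiv.subRight (pickedElement S C τ c))

/-- A good assignment gives an approximate isomorphism. -/
theorem approxIsomorphic_of_isSatisfiableFraction (eS : S ≃ Fin s) {ε : ℝ} (hε : 0 ≤ ε)
    (hC : IsSatisfiableFraction (S : Set (Fin k → H)) (1 - ε) C) :
    ApproxIsomorphic (1 - ε) (gadgetGraph v C) (gadgetGraph v (homogeneous C)) := by
  obtain ⟨τ, hτ⟩ := hC
  have : Finite S := .of_equiv _ eS.symm
  refine ⟨v.symm.trans ((assignmentEquiv C τ).trans v),
    (isApproxIso_gadgetGraph_iff v C eS _ _ (by linarith)).2 ?_⟩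
  have hsub : {c | ConstraintSatisfied (S : Set (Fin k → H)) (C c) τ} ×ˢ
      (Set.univ : Set (S × Fin k)) ⊆ {x | (gadgetEdge v C x).map
        (v.symm.trans ((assignmentEquiv C τ).trans v)) ∈
          Set.range (gadgetEdge v (homogeneous C))} := by
    rintro ⟨c, t, l⟩ ⟨hc, -⟩
    -- The image edge keeps its constraint and coordinate. On the variable side t_l - a_l - τ(j_l)
    -- equals (t - p)_l for the picked element p.
    refine ⟨(c, t - pickedElement S C τ c, l), ?_⟩
    have hp : pickedElement S C τ c = ⟨_, hc⟩ := dif_pos hc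
    simp only [gadgetEdge, assignmentEquiv, varEnd, homogeneous, Sym2.map_mk, Equiv.trans_apply,
      Equiv.symm_apply_apply, Equiv.sumCongr_apply, Sum.map_inr, Sum.map_inl,
      Equiv.prodShear_apply, Equiv.refl_apply, Equiv.subRight_apply, hp]
    refine congrArg (fun x => s(v (.inr _), v (.inl (_, x)))) ?_
    simp only [AddSubgroup.coe_sub, Pi.sub_apply, Pi.zero_apply]
    abel
  have hcard := Set.ncard_le_ncard hsub
  rw [Set.ncard_prod, Set.ncard_univ, Nat.card_prod, Nat.card_congr eS, Nat.card_fin,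
    Nat.card_fin] at hcard
  calc (1 - ε) * (m * (s * k) : ℕ) = (1 - ε) * m * (s * k : ℕ) := by push_cast; ring
    _ ≤ _ := mul_le_mul_of_nonneg_right hτ (Nat.cast_nonneg _)
    _ ≤ _ := by exact_mod_cast hcard

/-- The maps `f` and `g` of the variable vertices and of the vertices `(c, 0)` preserve the edges
at the vertex `(c, 0)`, and this is mapped to a constraint vertex. -/
def StarPreserved (C : AdditiveInstance k H n m) (f : Fin n × H → GadgetVertex S n m)
    (g : Fin m → GadgetVertex S n m) (c : Fin m) : Prop :=
  ∃ c' t', g c = .inr (c', t') ∧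
    ∀ l, ∃ l', f ((C c).1 l, -(C c).2 l) = .inl ((C c').1 l', t'.1 l')

/-- An approximate isomorphism preserves most stars. -/
theorem exists_starPreserved_of_approxIsomorphic (eH : H ≃ Fin d) (eS : S ≃ Fin s) (hk : 0 < k)
    (h : ApproxIsomorphic (1 - 1 / (8 * (s * k) : ℕ)) (gadgetGraph v C)
      (gadgetGraph v (homogeneous C))) :
    ∃ (f : Fin n × H → GadgetVertex S n m) (g : Fin m → GadgetVertex S n m),
      Function.Injective f ∧ 8 * {c | ¬ StarPreserved C f g c}.ncard ≤ m + 8 * (n * d) := by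
  have : Finite S := .of_equiv _ eS.symm
  have : Finite H := .of_equiv _ eH.symm
  have hs : 0 < s := Fin.pos (eS 0)
  have hsk : 0 < s * k := Nat.mul_pos hs hk
  obtain ⟨π, hπ⟩ := h
  rw [isApproxIso_gadgetGraph_iff v C eS _ _ (sub_le_self _ (by positivity))] at hπ
  set P := {x | (gadgetEdge v C x).map π ∈ Set.range (gadgetEdge v (homogeneous C))} with hP
  -- The loss 1/(8sk) is chosen so that of the m·s·k edges at most m/8 are lost.
  have hPc : 8 * Pᶜ.ncard ≤ m := by
    have hadd := Set.ncard_add_ncard_compl P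
    rw [Nat.card_prod, Nat.card_prod, Nat.card_congr eS, Nat.card_fin, Nat.card_fin,
      Nat.card_fin] at hadd
    have hadd' : (P.ncard : ℝ) + Pᶜ.ncard = (m * (s * k) : ℕ) := by exact_mod_cast hadd
    have e : (1 / (8 * (s * k) : ℕ) : ℝ) * (m * (s * k) : ℕ) = m / 8 := by
      have : (s : ℝ) ≠ 0 := by positivity
      have : (k : ℝ) ≠ 0 := by positivity
      push_cast
      field_simp
    rw [sub_mul, e] at hπ
    have : (8 * Pᶜ.ncard : ℝ) ≤ m := by linarith
    exact_mod_cast this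
  let π' : GadgetVertex S n m ≃ GadgetVertex S n m := v.trans (π.trans v.symm)
  refine ⟨fun x => π' (.inl x), fun c => π' (.inr (c, 0)),
    π'.injective.comp Sum.inl_injective, ?_⟩
  -- A star fails only if one of its edges is lost or its centre goes to a variable vertex. The
  -- latter happens at most n·d times, by injectivity.
  have hsub : {c | ¬ StarPreserved C (fun x => π' (.inl x)) (fun c => π' (.inr (c, 0))) c} ⊆
      Prod.fst '' Pᶜ ∪ {c | ∃ x, π' (.inr (c, 0)) = .inl x} := by
    intro c hc
    by_contra hcon
    simp only [Set.mem_union, Set.mem_image, Set.mem_compl_iff, not_or, not_exists, not_and,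
      Set.mem_ofPred_eq] at hcon
    refine hc ?_
    obtain ⟨⟨c', t'⟩, h'⟩ : ∃ y, π' (.inr (c, 0)) = .inr y := by
      rcases hx : π' (.inr (c, 0)) with x | y
      · exact absurd hx (hcon.2 x)
      · exact ⟨y, rfl⟩
    refine ⟨c', t', h', fun l => ?_⟩
    have hmem : (c, (0 : S), l) ∈ P := by
      by_contra hn
      exact hcon.1 _ hn rfl
    obtain ⟨⟨c₁, t₁, l₁⟩, hx⟩ := hmem
    have hv : ∀ y, π (v y) = v (π' y) := fun y => by simp [π']
    -- The image of the centre is a constraint vertex, so the edge can be matched in one orientation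
    -- only.
    simp only [gadgetEdge, varEnd, homogeneous, Sym2.map_mk, hv, h', Sym2.eq_iff,
      EmbeddingLike.apply_eq_iff_eq, Sum.inr.injEq, Prod.mk.injEq, reduceCtorEq,
      and_false, or_false] at hx
    obtain ⟨⟨rfl, rfl⟩, hx⟩ := hx
    exact ⟨l₁, by simpa using hx.symm⟩
  have h₁ : (Prod.fst '' Pᶜ).ncard ≤ Pᶜ.ncard := Set.ncard_image_le
  have h₂ : {c | ∃ x, π' (.inr (c, 0)) = .inl x}.ncard ≤ n * d := by
    have hinj : ∀ c c', π' (.inr (c, 0)) = π' (.inr (c', 0)) → c = c' := fun c c' h => by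
      simpa using π'.injective h
    have := Set.ncard_le_ncard_of_injOn (s := {c | ∃ x, π' (.inr (c, 0)) = .inl x})
      (t := Set.range (Sum.inl : Fin n × H → GadgetVertex S n m)) (fun c => π' (.inr (c, 0)))
      (fun c ⟨x, hx⟩ => ⟨x, hx.symm⟩) fun c _ c' _ h => hinj c c' h
    rwa [← Set.image_univ, Set.ncard_image_of_injective _ Sum.inl_injective, Set.ncard_univ,
      Nat.card_prod, Nat.card_congr eH, Nat.card_fin, Nat.card_fin] at this
  have h₃ := (Set.ncard_le_ncard hsub).trans (Set.ncard_union_le _ _)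
  omega

end Gadget

/-! ## Random instances have no approximate isomorphism -/

theorem Set.ncard_le_card_mul_of_subset_iUnion {W α : Type*} [Finite W] [Finite α] {A : Set α}
    {Z : W → Set α} {b : ℕ} (hA : ∀ x ∈ A, ∃ w, x ∈ Z w) (hZ : ∀ w, (Z w).ncard ≤ b) :
    A.ncard ≤ Nat.card W * b := by
  classical
  have := Fintype.ofFinite W
  have := Fintype.ofFinite α
  have hsub : A.toFinset ⊆ Finset.univ.biUnion fun w => (Z w).toFinset := fun x hx => by
    simpa using hA x (by simpa using hx)
  rw [Set.ncard_eq_toFinset_card', Nat.card_eq_fintype_card, ← Finset.card_univ]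
  exact (Finset.card_le_card hsub).trans (Finset.card_biUnion_le_card_mul _ _ _ fun w _ => by
    rw [← Set.ncard_eq_toFinset_card']; exact hZ w)

theorem Set.ncard_le_of_subset_union_union {α : Type*} [Finite α] {A B₁ B₂ B₃ B₄ : Set α}
    (h : A ⊆ (B₁ ∪ B₂) ∪ (B₃ ∪ B₄)) : A.ncard ≤ B₁.ncard + B₂.ncard + (B₃.ncard + B₄.ncard) :=
  (Set.ncard_le_ncard h).trans ((Set.ncard_union_le _ _).trans
    (Nat.add_le_add (Set.ncard_union_le _ _) (Set.ncard_union_le _ _)))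

/-- An exponential moment bound for the number of coordinates with a given property. -/
theorem ncard_moment_bound {X : Type*} [Finite X] (B : X → Prop) (m q L : ℕ) :
    {C : Fin m → X | q ≤ {c | B (C c)}.ncard}.ncard * (L + 1) ^ q ≤
      (Nat.card X + L * {x | B x}.ncard) ^ m := by
  classical
  have := Fintype.ofFinite X
  have h₁ : ∑ x : X, (if B x then L + 1 else 1) = Nat.card X + L * {x | B x}.ncard := by
    have : ∀ x : X, (if B x then L + 1 else 1) = 1 + if B x then L else 0 := fun x => by
      split_ifs <;> ring
    simp only [this, Finset.sum_add_distrib, ← Finset.sum_filter, Finset.sum_const, smul_eq_mul,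
      Set.ncard_eq_toFinset_card', Set.toFinset_ofPred]
    simp [mul_comm]
  -- Give each `x` the weight `L + 1` if `B x` and 1 otherwise. The m-th power of the total weight
  -- is the sum over all `C` of the products of weights, and a `C` with `q` coordinates in `B`
  -- contributes at least `(L + 1) ^ q`.
  rw [← h₁, Fintype.sum_pow, Set.ncard_eq_toFinset_card', Set.toFinset_ofPred, ← smul_eq_mul,
    ← Finset.sum_const]
  refine (Finset.sum_le_sum fun C hC => ?_).trans
    (Finset.sum_le_sum_of_subset (Finset.filter_subset _ _))
  rw [Finset.prod_ite, Finset.prod_const, Finset.prod_const_one, mul_one]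
  refine Nat.pow_le_pow_right (by omega) ?_
  simpa [Set.ncard_eq_toFinset_card', Set.toFinset_ofPred] using hC

/-- If the coordinates `e i` of `C` are determined by coordinates that precede them, then the
other coordinates determine `C`. -/
theorem ncard_determined_le {X : Type*} [Finite X] {m q : ℕ} {r : Fin m → Fin m → Prop}
    (hr : WellFounded r) {e : Fin q → Fin m} (he : e.Injective) {p : Fin q → Fin m}
    (hp : ∀ i, r (p i) (e i)) (R : Fin q → X → X → Prop)
    (hR : ∀ i y x x', R i y x → R i y x' → x = x') :
    {C : Fin m → X | ∀ i, R i (C (p i)) (C (e i))}.ncard ≤ Nat.card X ^ (m - q) := by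
  have hcard : Nat.card {c // c ∉ Set.range e} = m - q := by
    have := Set.ncard_add_ncard_compl (Set.range e)
    rw [← Set.image_univ, Set.ncard_image_of_injective _ he, Set.ncard_univ, Nat.card_fin,
      Nat.card_fin, Set.image_univ] at this
    have h' : Nat.card {c // c ∉ Set.range e} = (Set.range e)ᶜ.ncard := rfl
    omega
  have := Set.ncard_le_ncard_of_injOn (s := {C : Fin m → X | ∀ i, R i (C (p i)) (C (e i))})
    (t := Set.univ) (fun C (c : {c // c ∉ Set.range e}) => C c) (fun _ _ => Set.mem_univ _)
    fun C hC C' hC' h => ?_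
  · rwa [Set.ncard_univ, Nat.card_fun, hcard] at this
  · funext c
    -- Coordinates outside the range of `e` agree by assumption; the others are recovered along `r`,
    -- whose well-foundedness excludes circular determination.
    induction c using hr.induction with
    | _ c ih =>
      by_cases hc : c ∈ Set.range e
      · obtain ⟨i, rfl⟩ := hc
        have h₁ := hC i
        rw [ih _ (hp i)] at h₁
        exact hR i _ _ _ h₁ (hC' i)
      · exact congrFun h ⟨c, hc⟩

section Random

/-- The number of constraints. -/
theorem card_additiveConstraint (H : Type*) (k n : ℕ) :
    Nat.card (AdditiveConstraint k H n) = n.descFactorial k * Nat.card H ^ k := by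
  rw [Nat.card_prod, Nat.card_fun, Nat.card_fin, Nat.card_eq_fintype_card,
    Fintype.card_embedding_eq, Fintype.card_fin, Fintype.card_fin]

variable {H : Type*} [AddCommGroup H] {k n m : ℕ} {S : AddSubgroup (Fin k → H)}

theorem card_gadgetVertex [Finite H] :
    Nat.card (GadgetVertex S n m) = n * Nat.card H + m * Nat.card S := by
  rw [Nat.card_sum, Nat.card_prod, Nat.card_prod, Nat.card_fin, Nat.card_fin]

/-- The star of the constraint `c` is mapped to the star of a constraint that precedes it. -/
def Displaced (r : Fin m → Fin m → Prop) (C : AdditiveInstance k H n m)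
    (f : Fin n × H → GadgetVertex S n m) (c : Fin m) : Prop :=
  ∃ c' t', r c' c ∧ ∀ l, ∃ l', f ((C c).1 l, -(C c).2 l) = .inl ((C c').1 l', (t' : S).1 l')

/-- Union bound over `f` and, for each of `q` displaced stars, over the place `c`, its image `(c',
t')` and the matching of coordinates. Given these, injectivity of `f` recovers `C c` from `C c'`, so
`q` coordinates of `C` are no longer free. Taking one relation `r` at a time, `<` or `>`, avoids
cycles. -/
theorem ncard_displaced_le [Finite H] {r : Fin m → Fin m → Prop} (hr : WellFounded r) (q : ℕ) :
    {C : AdditiveInstance k H n m | ∃ f : Fin n × H → GadgetVertex S n m, f.Injective ∧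
        q ≤ {c | Displaced r C f c}.ncard}.ncard ≤
      (n * Nat.card H + m * Nat.card S) ^ (n * Nat.card H) *
        (m * (m * Nat.card S * k ^ k)) ^ q * Nat.card (AdditiveConstraint k H n) ^ (m - q) := by
  have hW : Nat.card ((Fin n × H → GadgetVertex S n m) ×
      (Fin q → Fin m × (Fin m × S) × (Fin k → Fin k))) =
      (n * Nat.card H + m * Nat.card S) ^ (n * Nat.card H) *
        (m * (m * Nat.card S * k ^ k)) ^ q := by
    simp only [Nat.card_prod, Nat.card_fun, card_gadgetVertex, Nat.card_fin]
  rw [← hW]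
  refine Set.ncard_le_card_mul_of_subset_iUnion (Z := fun w => {C : AdditiveInstance k H n m |
    w.1.Injective ∧ (fun i => (w.2 i).1).Injective ∧ (∀ i, r (w.2 i).2.1.1 (w.2 i).1) ∧
    ∀ i l, w.1 ((C (w.2 i).1).1 l, -(C (w.2 i).1).2 l) =
      .inl ((C (w.2 i).2.1.1).1 ((w.2 i).2.2 l), (w.2 i).2.1.2.1 ((w.2 i).2.2 l))})
    ?_ fun ⟨f, w⟩ => ?_
  · rintro C ⟨f, hf, hq⟩
    have hq' : Fintype.card (Fin q) ≤ Nat.card {c | Displaced r C f c} := by simpa using hq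
    have := Fintype.ofFinite {c | Displaced r C f c}
    rw [Nat.card_eq_fintype_card] at hq'
    obtain ⟨e⟩ := Function.Embedding.nonempty_of_card_le hq'
    choose c' t' hr' l' hl' using fun i => (e i).2
    exact ⟨(f, fun i => ((e i).1, (c' i, t' i), l' i)), hf,
      Subtype.val_injective.comp e.injective, hr', hl'⟩
  · by_cases h : f.Injective ∧ (fun i => (w i).1).Injective ∧ ∀ i, r (w i).2.1.1 (w i).1
    · refine le_trans (Set.ncard_le_ncard fun C hC => hC.2.2.2) (ncard_determined_le hr h.2.1 h.2.2
        (fun i (y x : AdditiveConstraint k H n) => ∀ l, f (x.1 l, -x.2 l) =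
          .inl (y.1 ((w i).2.2 l), (w i).2.1.2.1 ((w i).2.2 l))) fun i y x x' hx hx' => ?_)
      have h' : ∀ l, x.1 l = x'.1 l ∧ x.2 l = x'.2 l := fun l => by
        simpa using h.1 ((hx l).trans (hx' l).symm)
      exact Prod.ext (DFunLike.ext _ _ fun l => (h' l).1) (funext fun l => (h' l).2)
    · rw [show {C : AdditiveInstance k H n m | _} = ∅ from
        Set.eq_empty_of_forall_notMem fun C hC => h ⟨hC.1, hC.2.1, hC.2.2.1⟩]
      simp

/-- `f` maps a vertex of the constraint to a vertex at another variable of the constraint. -/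
def Swaps (f : Fin n × H → GadgetVertex S n m) (x : AdditiveConstraint k H n) : Prop :=
  ∃ l l', l' ≠ l ∧ ∃ h, f (x.1 l, -x.2 l) = .inl (x.1 l', h)

/-- For fixed `l ≠ l'` the index at `l'` can be read off from the image under `f` of the leaf at
`l`. One of the `k` indices is thus redundant, which saves a factor `n`. -/
theorem ncard_swaps_le [Finite H] (f : Fin n × H → GadgetVertex S n m) :
    {x : AdditiveConstraint k H n | Swaps f x}.ncard ≤
      k * k * (n ^ (k - 1) * Nat.card H ^ k) := by
  have hW : Nat.card (Fin k × Fin k) = k * k := by simp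
  rw [← hW]
  refine Set.ncard_le_card_mul_of_subset_iUnion (Z := fun w : Fin k × Fin k =>
    {x : AdditiveConstraint k H n | w.2 ≠ w.1 ∧
    ∃ h, f (x.1 w.1, -x.2 w.1) = .inl (x.1 w.2, h)}) (fun x ⟨l, l', h⟩ => ⟨(l, l'), h⟩)
    fun ⟨l, l'⟩ => ?_
  have hcard : Nat.card {i : Fin k // i ≠ l'} = k - 1 := by
    rw [Nat.card_eq_fintype_card, Fintype.card_subtype_compl]
    simp
  have := Set.ncard_le_ncard_of_injOn (s := {x : AdditiveConstraint k H n | l' ≠ l ∧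
    ∃ h, f (x.1 l, -x.2 l) = .inl (x.1 l', h)}) (t := Set.univ)
    (fun x => ((fun i : {i : Fin k // i ≠ l'} => x.1 i), x.2)) (fun _ _ => Set.mem_univ _) ?_
  · rwa [Set.ncard_univ, Nat.card_prod, Nat.card_fun, Nat.card_fun, hcard, Nat.card_fin,
      Nat.card_fin] at this
  · rintro x ⟨hl, h, hx⟩ x' ⟨-, h', hx'⟩ hxx'
    simp only [Prod.mk.injEq] at hxx'
    have hne : ∀ i, i ≠ l' → x.1 i = x'.1 i := fun i hi => congrFun hxx'.1 ⟨i, hi⟩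
    refine Prod.ext (DFunLike.ext _ _ fun i => ?_) hxx'.2
    by_cases hi : i = l'
    · subst hi
      rw [hne l hl.symm, hxx'.2, hx'] at hx
      simpa using (congrArg Prod.fst (Sum.inl_injective hx)).symm
    · exact hne i hi

theorem ncard_exists_swaps_le [Finite H] (q L : ℕ) :
    {C : AdditiveInstance k H n m | ∃ f : Fin n × H → GadgetVertex S n m,
        q ≤ {c | Swaps f (C c)}.ncard}.ncard * (L + 1) ^ q ≤
      (n * Nat.card H + m * Nat.card S) ^ (n * Nat.card H) *
        (Nat.card (AdditiveConstraint k H n) +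
          L * (k * k * (n ^ (k - 1) * Nat.card H ^ k))) ^ m := by
  have hW : Nat.card (Fin n × H → GadgetVertex S n m) =
      (n * Nat.card H + m * Nat.card S) ^ (n * Nat.card H) := by
    simp only [Nat.card_prod, Nat.card_fun, card_gadgetVertex, Nat.card_fin]
  rw [← hW]
  -- The moment bound controls a product with `(L + 1) ^ q`; the floor of the quotient is the
  -- uniform bound for one `f`, and multiplying back only decreases.
  have key := Set.ncard_le_card_mul_of_subset_iUnion
    (A := {C : AdditiveInstance k H n m | ∃ f : Fin n × H → GadgetVertex S n m,
        q ≤ {c | Swaps f (C c)}.ncard})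
    (Z := fun f : Fin n × H → GadgetVertex S n m => {C | q ≤ {c | Swaps f (C c)}.ncard})
    (b := (Nat.card (AdditiveConstraint k H n) +
      L * (k * k * (n ^ (k - 1) * Nat.card H ^ k))) ^ m / (L + 1) ^ q) (fun C h => h) fun f => ?_
  · refine (Nat.mul_le_mul_right _ key).trans ?_
    rw [Nat.mul_assoc]
    exact Nat.mul_le_mul_left _ (Nat.div_mul_le_self _ _)
  · rw [Nat.le_div_iff_mul_le (by positivity)]
    refine (ncard_moment_bound (Swaps f) m q L).trans ?_
    gcongr
    exact ncard_swaps_le f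

/-- The constraint is satisfied in the sense of partial permutations `g i` of the group. -/
def Matches (S : AddSubgroup (Fin k → H)) (g : Fin n → H → Option H)
    (x : AdditiveConstraint k H n) : Prop :=
  ∃ t : S, ∀ l, g (x.1 l) (-x.2 l) = some (t.1 l)

/-- Once the indices are fixed, the element `t` of the subgroup determines all shifts, because each
partial map `g i` is injective where defined. -/
theorem ncard_matches_le [Finite H] {g : Fin n → H → Option H}
    (hg : ∀ i h h' y, g i h = some y → g i h' = some y → h = h') :
    {x | Matches S g x}.ncard ≤ n.descFactorial k * Nat.card S := by
  choose! t ht using fun (x : AdditiveConstraint k H n) (hx : Matches S g x) => hx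
  have := Set.ncard_le_ncard_of_injOn (s := {x | Matches S g x}) (t := Set.univ)
    (fun x => (x.1, t x)) (fun _ _ => Set.mem_univ _) ?_
  · rwa [Set.ncard_univ, Nat.card_prod, Nat.card_eq_fintype_card (α := Fin k ↪ Fin n),
      Fintype.card_embedding_eq, Fintype.card_fin, Fintype.card_fin] at this
  · rintro ⟨j, a⟩ hx ⟨j', a'⟩ hx' h
    simp only [Prod.mk.injEq] at h
    obtain ⟨rfl, h⟩ := h
    have h₁ := ht _ hx
    have h₂ := ht _ hx'
    rw [← h] at h₂
    exact Prod.ext rfl (funext fun l => neg_injective (hg _ _ _ _ (h₁ l) (h₂ l)))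

/-- A proper subgroup has index at least two. -/
theorem two_mul_card_le [Finite H] (hS : S ≠ ⊤) : 2 * Nat.card S ≤ Nat.card H ^ k := by
  have hcard : Nat.card (Fin k → H) = Nat.card H ^ k := by rw [Nat.card_fun, Nat.card_fin]
  rw [← hcard]
  obtain ⟨c, hc⟩ := S.card_addSubgroup_dvd_card
  have hpos : 0 < Nat.card (Fin k → H) := Nat.card_pos
  rw [hc, Nat.mul_comm]
  refine Nat.mul_le_mul_left _ ?_
  by_contra hlt
  have : c = 0 ∨ c = 1 := by omega
  rcases this with rfl | rfl
  · omega
  · exact hS (AddSubgroup.eq_top_of_card_eq S (by omega))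

theorem ncard_exists_matches_le [Finite H] (hS : S ≠ ⊤) (q : ℕ) :
    {C : AdditiveInstance k H n m | ∃ g : Fin n → H → Option H,
        (∀ i h h' y, g i h = some y → g i h' = some y → h = h') ∧
        q ≤ {c | Matches S g (C c)}.ncard}.ncard * 3 ^ q ≤
      ((Nat.card H + 1) ^ Nat.card H) ^ n *
        (2 * Nat.card (AdditiveConstraint k H n)) ^ m := by
  have hW : Nat.card (Fin n → H → Option H) = ((Nat.card H + 1) ^ Nat.card H) ^ n := by
    rw [Nat.card_fun, Nat.card_fun, Nat.card_fin, Finite.card_option]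
  rw [← hW]
  have key := Set.ncard_le_card_mul_of_subset_iUnion
    (A := {C : AdditiveInstance k H n m | ∃ g : Fin n → H → Option H,
        (∀ i h h' y, g i h = some y → g i h' = some y → h = h') ∧
        q ≤ {c | Matches S g (C c)}.ncard})
    (Z := fun g => {C | (∀ i h h' y, g i h = some y → g i h' = some y → h = h') ∧
      q ≤ {c | Matches S g (C c)}.ncard})
    (b := (2 * Nat.card (AdditiveConstraint k H n)) ^ m / 3 ^ q) (fun C h => h) fun g => ?_
  · refine (Nat.mul_le_mul_right _ key).trans ?_
    rw [Nat.mul_assoc]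
    exact Nat.mul_le_mul_left _ (Nat.div_mul_le_self _ _)
  · by_cases hg : ∀ i h h' y, g i h = some y → g i h' = some y → h = h'
    · rw [Nat.le_div_iff_mul_le (by positivity)]
      refine (Nat.mul_le_mul_right _ (Set.ncard_le_ncard fun C hC => hC.2)).trans
        ((ncard_moment_bound (Matches S g) m q 2).trans ?_)
      -- With `L = 2` the base is the number of constraints plus twice the number of matching ones,
      -- hence at most doubled, since at most half of all constraints match.
      refine Nat.pow_le_pow_left ?_ m
      have h₁ := ncard_matches_le (S := S) hg
      have h₂ := Nat.mul_le_mul_left (n.descFactorial k) (two_mul_card_le hS)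
      rw [card_additiveConstraint]
      nlinarith
    · rw [show {C : AdditiveInstance k H n m | _} = ∅ from
        Set.eq_empty_of_forall_notMem fun C hC => hg hC.1]
      simp

/-- The partial permutations of the group that a map of the variable vertices induces. -/
noncomputable def fiberMap (f : Fin n × H → GadgetVertex S n m) (i : Fin n) (h : H) : Option H :=
  match f (i, h) with
  | .inl (i', h') => if i' = i then some h' else none
  | .inr _ => none

theorem fiberMap_eq_some {f : Fin n × H → GadgetVertex S n m} {i : Fin n} {h y : H} :
    fiberMap f i h = some y ↔ f (i, h) = .inl (i, y) := by
  unfold fiberMap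
  rcases f (i, h) with ⟨i', h'⟩ | x
  · by_cases hi : i' = i <;> simp [hi]
  · simp

/-- Every preserved star falls into one of four cases. -/
theorem StarPreserved.cases {C : AdditiveInstance k H n m}
    {f : Fin n × H → GadgetVertex S n m} {g : Fin m → GadgetVertex S n m}
    {c : Fin m} (h : StarPreserved C f g c) :
    Displaced (· < ·) C f c ∨ Displaced (· > ·) C f c ∨ Swaps f (C c) ∨
      Matches S (fiberMap f) (C c) := by
  obtain ⟨c', t', -, h⟩ := h
  rcases lt_trichotomy c' c with hc | rfl | hc
  · exact .inl ⟨c', t', hc, h⟩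
  · by_cases hs : Swaps f (C c')
    · exact .inr (.inr (.inl hs))
    · refine .inr (.inr (.inr ⟨t', fun l => ?_⟩))
      obtain ⟨l', hl'⟩ := h l
      obtain rfl : l' = l := by
        by_contra hne
        exact hs ⟨l, l', hne, _, hl'⟩
      exact fiberMap_eq_some.2 hl'
  · exact .inr (.inl ⟨c', t', hc, h⟩)

/-! ### Numerical estimates for the union bounds. -/

/-- Powers and falling factorials agree up to a constant factor. -/
theorem pow_le_two_pow_mul_descFactorial (h : 2 * k ≤ n) :
    n ^ k ≤ 2 ^ k * n.descFactorial k :=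
  calc n ^ k ≤ (2 * (n + 1 - k)) ^ k := Nat.pow_le_pow_left (by omega) k
    _ = 2 ^ k * (n + 1 - k) ^ k := Nat.mul_pow _ _ _
    _ ≤ _ := Nat.mul_le_mul_left _ (Nat.pow_sub_le_descFactorial n k)

theorem pow_le_two_pow_mul_card (H : Type*) (h : 2 * k ≤ n) :
    n ^ k * Nat.card H ^ k ≤ 2 ^ k * Nat.card (AdditiveConstraint k H n) := by
  rw [card_additiveConstraint, ← Nat.mul_assoc]
  exact Nat.mul_le_mul_right _ (pow_le_two_pow_mul_descFactorial h)

/-- Per variable the cost is n^d for `f` and n^(2(d+1)) for bookkeeping, in total n^(3d+2). The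
saving is at least of order n^(3(d+1)) since k ≥ 3. The spare factor `n` absorbs all constants and
the 2. -/
theorem displaced_estimate {b d s Δ Q n k : ℕ} (hk : 3 ≤ k) (hQ : n ^ k ≤ 2 ^ k * Q)
    (hn : 2 * b ^ d * (Δ * Δ * s * k ^ k * 2 ^ k) ^ (d + 1) ≤ n) (h1 : 1 ≤ n)
    (hΔ : d + 1 ≤ Δ) :
    (b * n) ^ (n * d) * (Δ * n * (Δ * n * s * k ^ k)) ^ ((d + 1) * n) *
      Q ^ (Δ * n - (d + 1) * n) * 2 ^ n ≤ Q ^ (Δ * n) := by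
  have h3 : n ^ 3 ≤ 2 ^ k * Q := (Nat.pow_le_pow_right h1 hk).trans hQ
  have base : (b * n) ^ d * (Δ * n * (Δ * n * s * k ^ k)) ^ (d + 1) * 2 ≤ Q ^ (d + 1) := by
    refine Nat.le_of_mul_le_mul_left (c := (2 ^ k) ^ (d + 1)) ?_ (by positivity)
    calc (2 ^ k) ^ (d + 1) * ((b * n) ^ d * (Δ * n * (Δ * n * s * k ^ k)) ^ (d + 1) * 2)
        = 2 * b ^ d * (Δ * Δ * s * k ^ k * 2 ^ k) ^ (d + 1) * n ^ (3 * d + 2) := by ring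
      _ ≤ n * n ^ (3 * d + 2) := Nat.mul_le_mul_right _ hn
      _ = (n ^ 3) ^ (d + 1) := by ring
      _ ≤ (2 ^ k * Q) ^ (d + 1) := Nat.pow_le_pow_left h3 _
      _ = _ := Nat.mul_pow _ _ _
  have hexp : (d + 1) * n + (Δ * n - (d + 1) * n) = Δ * n :=
    Nat.add_sub_cancel' (Nat.mul_le_mul_right _ hΔ)
  calc _ = ((b * n) ^ d * (Δ * n * (Δ * n * s * k ^ k)) ^ (d + 1) * 2) ^ n *
        Q ^ (Δ * n - (d + 1) * n) := by
        rw [Nat.mul_comm n d, Nat.pow_mul, Nat.pow_mul, Nat.mul_pow, Nat.mul_pow]; ring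
    _ ≤ (Q ^ (d + 1)) ^ n * Q ^ (Δ * n - (d + 1) * n) :=
        Nat.mul_le_mul_right _ (Nat.pow_le_pow_left base n)
    _ = Q ^ (Δ * n) := by rw [← Nat.pow_mul, ← Nat.pow_add, hexp]

/-- With `L + 1 = n` the weights change the total by a constant factor only, as swaps have density
O(1/n). The gain n^((d+1)n) then leaves a spare factor n^n over the number of maps. -/
theorem swaps_estimate {b d D Δ Q n k x : ℕ} (hk : 1 ≤ k) (hQ : n ^ k * D ≤ 2 ^ k * Q)
    (hn : 2 * b ^ d * (1 + k * k * 2 ^ k) ^ Δ ≤ n) (h1 : 1 ≤ n)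
    (hx : x * (n - 1 + 1) ^ ((d + 1) * n) ≤
      (b * n) ^ (n * d) * (Q + (n - 1) * (k * k * (n ^ (k - 1) * D))) ^ (Δ * n)) :
    x * 2 ^ n ≤ Q ^ (Δ * n) := by
  rw [Nat.sub_add_cancel h1] at hx
  have hsum : Q + (n - 1) * (k * k * (n ^ (k - 1) * D)) ≤ (1 + k * k * 2 ^ k) * Q := by
    have : (n - 1) * (k * k * (n ^ (k - 1) * D)) ≤ k * k * 2 ^ k * Q :=
      calc (n - 1) * (k * k * (n ^ (k - 1) * D)) ≤ n * (k * k * (n ^ (k - 1) * D)) :=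
            Nat.mul_le_mul_right _ (Nat.sub_le _ _)
        _ = k * k * (n ^ (k - 1 + 1) * D) := by ring
        _ = k * k * (n ^ k * D) := by rw [Nat.sub_add_cancel hk]
        _ ≤ k * k * (2 ^ k * Q) := Nat.mul_le_mul_left _ hQ
        _ = _ := by ring
    rw [Nat.add_mul, Nat.one_mul]
    omega
  refine Nat.le_of_mul_le_mul_right (c := n ^ ((d + 1) * n)) ?_ (by positivity)
  calc x * 2 ^ n * n ^ ((d + 1) * n) = x * n ^ ((d + 1) * n) * 2 ^ n := by ring
    _ ≤ (b * n) ^ (n * d) * ((1 + k * k * 2 ^ k) * Q) ^ (Δ * n) * 2 ^ n :=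
        Nat.mul_le_mul_right _ (hx.trans (Nat.mul_le_mul_left _ (Nat.pow_le_pow_left hsum _)))
    _ = ((2 * b ^ d * (1 + k * k * 2 ^ k) ^ Δ) * n ^ d) ^ n * Q ^ (Δ * n) := by
        rw [Nat.mul_comm n d, Nat.mul_pow _ Q, Nat.pow_mul, Nat.pow_mul (1 + k * k * 2 ^ k)]
        ring
    _ ≤ (n * n ^ d) ^ n * Q ^ (Δ * n) :=
        Nat.mul_le_mul_right _ (Nat.pow_le_pow_left (Nat.mul_le_mul_right _ hn) n)
    _ = Q ^ (Δ * n) * n ^ ((d + 1) * n) := by ring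

/-- The threshold is three quarters of the 8yn constraints, and 3^6 = 729 exceeds 2·2^8 = 512. The
surplus 2^y pays for the `A` choices per variable and a further 2. -/
theorem matches_estimate {A y Q n x : ℕ} (hA : 2 * A ≤ y)
    (hx : x * 3 ^ (6 * y * n) ≤ A ^ n * (2 * Q) ^ (8 * y * n)) :
    x * 2 ^ n ≤ Q ^ (8 * y * n) := by
  have base : 2 * A * 256 ^ y ≤ 729 ^ y :=
    calc 2 * A * 256 ^ y ≤ 2 ^ y * 256 ^ y :=
          Nat.mul_le_mul_right _ (hA.trans y.lt_two_pow_self.le)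
      _ = 512 ^ y := by rw [← Nat.mul_pow]
      _ ≤ 729 ^ y := Nat.pow_le_pow_left (by norm_num) y
  have e₃ : 3 ^ (6 * y * n) = (729 ^ y) ^ n := by
    rw [Nat.pow_mul, Nat.pow_mul]
  have e₂ : 2 ^ (8 * y * n) = (256 ^ y) ^ n := by
    rw [Nat.pow_mul, Nat.pow_mul]
  refine Nat.le_of_mul_le_mul_right (c := 3 ^ (6 * y * n)) ?_ (by positivity)
  calc x * 2 ^ n * 3 ^ (6 * y * n) = x * 3 ^ (6 * y * n) * 2 ^ n := by ring
    _ ≤ A ^ n * (2 * Q) ^ (8 * y * n) * 2 ^ n := Nat.mul_le_mul_right _ hx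
    _ = (2 * A * 256 ^ y) ^ n * Q ^ (8 * y * n) := by
        rw [Nat.mul_pow 2 Q, e₂, Nat.mul_pow, Nat.mul_pow]; ring
    _ ≤ (729 ^ y) ^ n * Q ^ (8 * y * n) :=
        Nat.mul_le_mul_right _ (Nat.pow_le_pow_left base n)
    _ = _ := by rw [e₃]; ring

/-- For almost all instances no map of the vertices preserves most stars. -/
theorem exists_ncard_starPreserved_le [Finite H] (hk : 3 ≤ k) (hS : S ≠ ⊤) :
    ∃ Δ, 0 < Δ ∧ ∃ n₀, ∀ n ≥ n₀,
      {C : AdditiveInstance k H n (Δ * n) | ∃ (f : Fin n × H → GadgetVertex S n (Δ * n))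
        (g : Fin (Δ * n) → GadgetVertex S n (Δ * n)), f.Injective ∧
        8 * {c | ¬ StarPreserved C f g c}.ncard ≤ Δ * n + 8 * (n * Nat.card H)}.ncard * 2 ^ n ≤
      4 * Nat.card (AdditiveInstance k H n (Δ * n)) := by
  set d := Nat.card H with hd
  set s := Nat.card S with hs
  have hd1 : 0 < d := Nat.card_pos
  set A := (d + 1) ^ d with hA
  -- The term 2A serves `matches_estimate`; 4d + 3 makes m/8 = yn cover the nd centres sent to
  -- variable vertices and the 3(d+1)n stars of the three rare types.
  set y := 2 * A + 4 * d + 3 with hy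
  set Δ := 8 * y with hΔ
  set b := d + Δ * s with hb
  refine ⟨Δ, by omega, 2 * k + 1 + 2 * b ^ d * (Δ * Δ * s * k ^ k * 2 ^ k) ^ (d + 1) +
    2 * b ^ d * (1 + k * k * 2 ^ k) ^ Δ, fun n hn => ?_⟩
  set Q := Nat.card (AdditiveConstraint k H n) with hQ
  have hbn : n * d + Δ * n * s = b * n := by rw [hb]; ring
  have hcard : Nat.card (AdditiveInstance k H n (Δ * n)) = Q ^ (Δ * n) := by
    rw [Nat.card_fun, Nat.card_fin]
  have hQ₁ : n ^ k * d ^ k ≤ 2 ^ k * Q := pow_le_two_pow_mul_card H (by omega)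
  have hQ₂ : n ^ k ≤ 2 ^ k * Q :=
    (Nat.le_mul_of_pos_right _ (by positivity)).trans hQ₁
  have hdis : ∀ r : Fin (Δ * n) → Fin (Δ * n) → Prop, WellFounded r →
      {C : AdditiveInstance k H n (Δ * n) | ∃ f : Fin n × H → GadgetVertex S n (Δ * n),
        f.Injective ∧ (d + 1) * n ≤ {c | Displaced r C f c}.ncard}.ncard * 2 ^ n ≤
        Q ^ (Δ * n) := fun r hr => by
    have := ncard_displaced_le (H := H) (S := S) (n := n) hr ((d + 1) * n)
    rw [← hd, ← hs, ← hQ, hbn] at this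
    exact (Nat.mul_le_mul_right _ this).trans
      (displaced_estimate hk hQ₂ (by omega) (by omega) (by omega))
  have h₁ := hdis (· < ·) wellFounded_lt
  have h₂ := hdis (· > ·) wellFounded_gt
  have h₃ : {C : AdditiveInstance k H n (Δ * n) | ∃ f : Fin n × H → GadgetVertex S n (Δ * n),
      (d + 1) * n ≤ {c | Swaps f (C c)}.ncard}.ncard * 2 ^ n ≤ Q ^ (Δ * n) := by
    have := ncard_exists_swaps_le (H := H) (S := S) (n := n) (m := Δ * n) ((d + 1) * n) (n - 1)
    rw [← hd, ← hs, ← hQ, hbn] at this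
    exact swaps_estimate (by omega) hQ₁ (by omega) (by omega) this
  have h₄ : {C : AdditiveInstance k H n (Δ * n) | ∃ g : Fin n → H → Option H,
      (∀ i h h' z, g i h = some z → g i h' = some z → h = h') ∧
      6 * y * n ≤ {c | Matches S g (C c)}.ncard}.ncard * 2 ^ n ≤ Q ^ (Δ * n) :=
    matches_estimate (A := A) (by omega) (ncard_exists_matches_le hS _)
  rw [hcard]
  have hfour : ∀ {a c₁ c₂ c₃ c₄ : ℕ}, c₁ * 2 ^ n ≤ Q ^ (Δ * n) → c₂ * 2 ^ n ≤ Q ^ (Δ * n) →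
      c₃ * 2 ^ n ≤ Q ^ (Δ * n) → c₄ * 2 ^ n ≤ Q ^ (Δ * n) → a ≤ c₁ + c₂ + (c₃ + c₄) →
      a * 2 ^ n ≤ 4 * Q ^ (Δ * n) := fun i₁ i₂ i₃ i₄ h => by
    refine (Nat.mul_le_mul_right _ h).trans ?_
    rw [Nat.add_mul, Nat.add_mul, Nat.add_mul]
    omega
  refine hfour h₁ h₂ h₃ h₄ (Set.ncard_le_of_subset_union_union ?_)
  rintro C ⟨f, g, hf, hfg⟩
  by_contra hcon
  simp only [Set.mem_union, Set.mem_ofPred_eq, not_or, not_exists, not_and, not_le] at hcon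
  obtain ⟨⟨c₁, c₂⟩, c₃, c₄⟩ := hcon
  replace c₁ := c₁ f hf
  replace c₂ := c₂ f hf
  replace c₃ := c₃ f
  replace c₄ := c₄ (fiberMap f) fun i h h' z hz hz' => by
    have := hf ((fiberMap_eq_some.1 hz).trans (fiberMap_eq_some.1 hz').symm)
    exact congrArg Prod.snd this
  -- If all four types stay below their thresholds, the constraints number fewer than m/8 + nd +
  -- 3(d+1)n + 3m/4, which is at most m: a contradiction.
  have hcover : (Set.univ : Set (Fin (Δ * n))) ⊆ {c | ¬ StarPreserved C f g c} ∪
      (({c | Displaced (· < ·) C f c} ∪ {c | Displaced (· > ·) C f c}) ∪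
        ({c | Swaps f (C c)} ∪ {c | Matches S (fiberMap f) (C c)})) := fun c _ => by
    by_cases hc : StarPreserved C f g c
    · have := hc.cases
      simp only [Set.mem_union, Set.mem_ofPred_eq]
      tauto
    · exact .inl hc
  have hn' := (Set.ncard_le_ncard hcover).trans ((Set.ncard_union_le _ _).trans
    (Nat.add_le_add_left (Set.ncard_le_of_subset_union_union subset_rfl) _))
  rw [Set.ncard_univ, Nat.card_fin] at hn'
  have e₁ : (d + 1) * n = n * d + n := by ring
  have e₂ : Δ * n = 8 * (y * n) := by rw [hΔ]; ring
  have e₃ : 6 * y * n = 6 * (y * n) := by ring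
  have e₄ : y * n = 2 * (A * n) + 4 * (n * d) + 3 * n := by rw [hy]; ring
  omega

end Random

/-! ## The refuter -/

section Refuter

variable {H : Type*} [AddCommGroup H] [Fintype H] {k n Δ s : ℕ} {S : AddSubgroup (Fin k → H)}

/-- The program that decides by means of `P` whether an instance is typical. -/
noncomputable def refuterProg (P : RamProg) (eS : S ≃ Fin s) : RamProg :=
  RamProg.reductionProg P (Fintype.card H) k s
    (edgeTable fun q l a => Fintype.equivFin H ((eS.symm q).1 l - (Fintype.equivFin H).symm a))
    (edgeTable fun q l _ => Fintype.equivFin H ((eS.symm q).1 l))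

/-- The two graphs of an instance are approximately isomorphic. -/
def GraphsIsomorphic (α : ℝ) (eS : S ≃ Fin s) {m : ℕ} (C : AdditiveInstance k H n m) : Prop :=
  ApproxIsomorphic α (gadgetGraph (vertexNum (Fintype.equivFin H) eS n m) C)
    (gadgetGraph (vertexNum (Fintype.equivFin H) eS n m) (homogeneous C))

/-- The constant of the running time of the refuter. -/
def refuterConst (d k s Δ : ℕ) : ℕ :=
  2 * (Δ * (s * (k * (d + 2 * d + 13) + 1 + 1) + 1 + 3 + 1) + d + 5) + (d + s + k * s + 13) + 3

/-- Since the answer of `P` is negated, a satisfiable instance, whose graphs `P` accepts, is never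
called typical. The constructed graphs have (d + Δs)n vertices. -/
theorem refuterProg_spec {P : RamProg} {ε δ : ℝ} {t : ℕ → ℕ} (eS : S ≃ Fin s)
    (hP : Distinguishes P ε δ (Δ * (s * k)) t) (ht : ∀ n, n ≤ t n)
    (C : AdditiveInstance k H n (Δ * n)) :
    (refuterProg P eS).HaltsWithin (instanceWords C)
      (refuterConst (Fintype.card H) k s Δ * t ((Fintype.card H + Δ * s) * n) +
        refuterConst (Fintype.card H) k s Δ) ∧
    (GraphsIsomorphic (1 - ε) eS C → ¬ (refuterProg P eS).Accepts (instanceWords C)) ∧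
    (¬ GraphsIsomorphic (1 - δ) eS C → (refuterProg P eS).Accepts (instanceWords C)) := by
  have hd : 0 < Fintype.card H := Fintype.card_pos
  have hN : n * Fintype.card H + Δ * n * s = (Fintype.card H + Δ * s) * n := by ring
  have hn : n ≤ (Fintype.card H + Δ * s) * n := Nat.le_mul_of_pos_left _ (by omega)
  have hedges : Δ * n * (s * k) ≤ Δ * (s * k) * (n * Fintype.card H + Δ * n * s) := by
    rw [hN]
    calc Δ * n * (s * k) = Δ * (s * k) * n := by ring
      _ ≤ _ := Nat.mul_le_mul_left _ hn
  obtain ⟨hT, hacc, hrej⟩ := hP _ _ _ _ _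
    (ncard_edgeSet_gadgetGraph (vertexNum (Fintype.equivFin H) eS n (Δ * n)) C eS)
    (ncard_edgeSet_gadgetGraph _ (homogeneous C) eS) hedges (isPairEncoding_gadgetGraph eS C)
  rw [hN] at hT
  have run := fun {σ} hσ => RamProg.runs_reductionProg (P := P) (σ := σ)
    ((List.ofFn C).flatMap constraintWords) n (Δ * n) (Fintype.card H) k s
    (t := edgeTable fun q l a => Fintype.equivFin H ((eS.symm q).1 l - (Fintype.equivFin H).symm a))
    (t' := edgeTable fun q l _ => Fintype.equivFin H ((eS.symm q).1 l))
    (fun _ _ => by simp [edgeTable]) (fun _ _ => by simp [edgeTable]) hT hσ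
  refine ⟨?_, fun h => ?_, fun h => ?_⟩
  · obtain ⟨r, hr, σ, e⟩ := hT
    refine ((run ⟨r, e⟩).le ?_).haltsWithin
    -- The linear time for writing the graphs is absorbed by the running time of `P`.
    have h₁ : n ≤ t ((Fintype.card H + Δ * s) * n) := hn.trans (ht _)
    generalize t ((Fintype.card H + Δ * s) * n) = T at h₁
    simp only [refuterConst]
    generalize s * (k * (Fintype.card H + 2 * Fintype.card H + 13) + 1 + 1) + 1 + 3 + 1 = x
    have h₂ : Δ * n * x ≤ Δ * x * T := by
      calc Δ * n * x = Δ * x * n := by ring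
        _ ≤ _ := Nat.mul_le_mul_left _ h₁
    nlinarith [Nat.zero_le (k * s * T), Nat.zero_le (s * T), Nat.zero_le (Fintype.card H * T)]
  · obtain ⟨σ, hσ, h0⟩ := hacc h
    refine RamProg.Rejects.not_accepts (((run hσ).mono le_rfl fun τ hτ => ?_).rejects)
    rw [hτ, if_neg h0]
  · obtain ⟨σ, hσ, h0⟩ := hrej h
    refine ((run hσ).mono le_rfl fun τ hτ => ?_).accepts
    rw [hτ, if_pos h0]
    exact one_ne_zero

theorem tendsto_accepted {P' : RamProg} {δ : ℝ} {n₀ : ℕ} (eS : S ≃ Fin s)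
    (hbad : ∀ n ≥ n₀, {C : AdditiveInstance k H n (Δ * n) | GraphsIsomorphic δ eS C}.ncard * 2 ^ n ≤
      4 * Nat.card (AdditiveInstance k H n (Δ * n)))
    (hP' : ∀ (n : ℕ) (C : AdditiveInstance k H n (Δ * n)), ¬ GraphsIsomorphic δ eS C →
      P'.Accepts (instanceWords C)) :
    Tendsto (fun n : ℕ =>
      ({C : AdditiveInstance k H n (Δ * n) | P'.Accepts (instanceWords C)}.ncard : ℝ) /
        (Nat.card (AdditiveInstance k H n (Δ * n)) : ℝ)) atTop (𝓝 1) := by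
  have hlim : Tendsto (fun n : ℕ => 1 - 4 * (1 / 2 : ℝ) ^ n) atTop (𝓝 1) := by
    simpa using (tendsto_pow_atTop_nhds_zero_of_lt_one (r := (1 / 2 : ℝ)) (by norm_num)
      (by norm_num)).const_mul 4 |>.const_sub 1
  refine tendsto_of_tendsto_of_tendsto_of_le_of_le' hlim tendsto_const_nhds ?_ ?_
  -- For n ≥ k there are k distinct indices, so instances exist and the quotient is meaningful.
  · filter_upwards [eventually_ge_atTop (max n₀ k)] with n hn
    have hpos : 0 < Nat.card (AdditiveInstance k H n (Δ * n)) := by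
      have : Nonempty (Fin k ↪ Fin n) := ⟨Fin.castLEEmb (by omega)⟩
      exact Nat.card_pos
    have hpos' : (0 : ℝ) < Nat.card (AdditiveInstance k H n (Δ * n)) := by exact_mod_cast hpos
    have hsub : {C : AdditiveInstance k H n (Δ * n) | GraphsIsomorphic δ eS C}ᶜ ⊆
        {C | P'.Accepts (instanceWords C)} := fun C hC => hP' n C hC
    have h₁ := Set.ncard_le_ncard hsub
    have h₂ := Set.ncard_add_ncard_compl
      {C : AdditiveInstance k H n (Δ * n) | GraphsIsomorphic δ eS C}
    have h₃ := hbad n (by omega)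
    generalize {C : AdditiveInstance k H n (Δ * n) | GraphsIsomorphic δ eS C}ᶜ.ncard = x at *
    generalize {C : AdditiveInstance k H n (Δ * n) | GraphsIsomorphic δ eS C}.ncard = z at *
    generalize {C : AdditiveInstance k H n (Δ * n) | P'.Accepts (instanceWords C)}.ncard = u at *
    generalize Nat.card (AdditiveInstance k H n (Δ * n)) = N at *
    rw [le_div_iff₀ hpos', one_div, inv_pow]
    have h₄ : (z : ℝ) ≤ 4 * ((2 : ℝ) ^ n)⁻¹ * N := by
      have : (z : ℝ) * 2 ^ n ≤ 4 * N := by exact_mod_cast h₃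
      have h2 : (0 : ℝ) < 2 ^ n := by positivity
      calc (z : ℝ) = z * 2 ^ n * (2 ^ n)⁻¹ := by field_simp
        _ ≤ 4 * N * (2 ^ n)⁻¹ := by gcongr
        _ = _ := by ring
    have h₅ : (z : ℝ) + x = N := by exact_mod_cast h₂
    have h₆ : (x : ℝ) ≤ u := by exact_mod_cast h₁
    linarith
  · refine Eventually.of_forall fun n => div_le_one_of_le₀ ?_ (Nat.cast_nonneg _)
    exact_mod_cast Set.ncard_le_card _

/-- A program that distinguishes pairs of graphs gives a refuter. -/
theorem exists_refuter_of_distinguishes (hk : 3 ≤ k) (hS : S ≠ ⊤) :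
    ∃ D : ℕ, 0 < D ∧ ∃ Δ K a b : ℕ, 0 < Δ ∧
      ∀ (ε : ℝ) (t : ℕ → ℕ), 0 < ε → (∀ n, n ≤ t n) →
        (∃ P : RamProg, Distinguishes P ε (1 / D) K t) →
        ∃ P' : RamProg, IsRefuter (S : Set (Fin k → H)) ε Δ (fun n => a * t (b * n) + a) P' := by
  obtain ⟨Δ, hΔ, n₀, hbad⟩ := exists_ncard_starPreserved_le hk hS
  let eS : S ≃ Fin (Nat.card S) := Finite.equivFin S
  have hs : 0 < Nat.card S := Nat.card_pos
  refine ⟨8 * (Nat.card S * k), by positivity, Δ, Δ * (Nat.card S * k),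
    refuterConst (Fintype.card H) k (Nat.card S) Δ, Fintype.card H + Δ * Nat.card S, hΔ,
    fun ε t hε ht ⟨P, hP⟩ => ⟨refuterProg P eS, fun n C => (refuterProg_spec eS hP ht C).1,
      tendsto_accepted eS (n₀ := n₀) (fun n hn => ?_)
        fun n C => (refuterProg_spec eS hP ht C).2.2,
      fun n C hC => (refuterProg_spec eS hP ht C).2.1
        (approxIsomorphic_of_isSatisfiableFraction _ C eS hε.le hC)⟩⟩
  refine (Nat.mul_le_mul_right _ (Set.ncard_le_ncard fun C hC => ?_)).trans (hbad n hn)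
  obtain ⟨f, g, hf, h⟩ := exists_starPreserved_of_approxIsomorphic _ C
    (Fintype.equivFin H) eS (by omega) hC
  rw [← Nat.card_eq_fintype_card] at h
  exact ⟨f, g, hf, h⟩

end Refuter

/-! ## The program that checks an approximate isomorphism -/

namespace RamProg

/-- The registers and arrays that stay fixed during the check: `w` is the input, `o` the map that
is to be checked. -/
structure CheckState (w o : ℕ → ℕ) (n m m' : ℕ) (τ : RamState) : Prop where
  one : τ.reg 1 = 1
  verts : τ.reg 6 = n
  edges : τ.reg 7 = m
  edges' : τ.reg 8 = m'
  input : τ.arr 0 = w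
  map : τ.arr 3 = o

variable {w o : ℕ → ℕ} {n m m' : ℕ} {σ : RamState}

theorem CheckState.setReg (h : CheckState w o n m m' σ) {i : ℕ}
    (hi : i ≠ 1 ∧ i ≠ 6 ∧ i ≠ 7 ∧ i ≠ 8) (x : ℕ) : CheckState w o n m m' (σ.setReg i x) := by
  obtain ⟨h1, h2, h3, h4, h5, h6⟩ := h
  obtain ⟨i1, i2, i3, i4⟩ := hi
  constructor <;> simp [*, i1.symm, i2.symm, i3.symm, i4.symm]

theorem CheckState.setArr_one (h : CheckState w o n m m' σ) (x y : ℕ) :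
    CheckState w o n m m' (σ.setArr 1 x y) := by
  obtain ⟨h1, h2, h3, h4, h5, h6⟩ := h
  constructor <;> simp [*]

/-- The first `c` values of `o` are different numbers below `n`. -/
def IsInjectionUpTo (o : ℕ → ℕ) (n c : ℕ) : Prop :=
  (∀ i < c, o i < n) ∧ ∀ i < c, ∀ j < c, o i = o j → i = j

theorem isInjectionUpTo_succ {c : ℕ} :
    IsInjectionUpTo o n (c + 1) ↔ IsInjectionUpTo o n c ∧ o c < n ∧ ¬ ∃ i < c, o i = o c := by
  constructor
  · rintro ⟨h₁, h₂⟩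
    exact ⟨⟨fun i hi => h₁ i (by omega), fun i hi j hj => h₂ i (by omega) j (by omega)⟩,
      h₁ c (by omega), fun ⟨i, hi, e⟩ => hi.ne (h₂ i (by omega) c (by omega) e)⟩
  · rintro ⟨⟨h₁, h₂⟩, h₃, h₄⟩
    refine ⟨fun i hi => ?_, fun i hi j hj e => ?_⟩
    · rcases Nat.lt_succ_iff_lt_or_eq.1 hi with hi | rfl
      exacts [h₁ i hi, h₃]
    · rcases Nat.lt_succ_iff_lt_or_eq.1 hi with hi | rfl <;>
        rcases Nat.lt_succ_iff_lt_or_eq.1 hj with hj | rfl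
      exacts [h₂ i hi j hj e, (h₄ ⟨i, hi, e⟩).elim, (h₄ ⟨j, hj, e.symm⟩).elim, rfl]

/-- Set register `4` to a nonzero value unless the map is injective with values below `n`. -/
def injectionProg : RamProg :=
  seq (const 2 0) <| seq (add 2 2 6) <| seq (const 3 0) <| seq (const 4 0) <| loop 2 <|
    seq (load 9 3 3) <| seq (sub 10 6 9) <|
    seq (ite 10 (seq (load 11 1 9) (ite 11 (const 4 1) (const 11 0))) (const 4 1)) <|
    seq (store 1 9 1) <| seq (add 3 3 1) (sub 2 2 1)

/-- Array 1 marks the values already seen, which keeps the check linear. Once register `4` becomes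
nonzero it stays so. -/
theorem runs_injectionProg (h : CheckState w o n m m' σ) (h1 : σ.arr 1 = fun _ => 0) :
    injectionProg.Runs σ (n * 10 + 5) fun τ =>
      CheckState w o n m m' τ ∧ (τ.reg 4 = 0 ↔ IsInjectionUpTo o n n) := by
  refine Runs.le (T₁ := 1 + (1 + (1 + (1 + (n * (9 + 1) + 1))))) ?_ (by omega)
  refine runs_seq <| runs_const <| runs_seq <| runs_add <| runs_seq <| runs_const <| runs_seq <|
    runs_const <| (runs_loop (fun c τ => CheckState w o n m m' τ ∧ τ.reg 2 = n - c ∧ τ.reg 3 = c ∧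
      (τ.reg 4 = 0 ↔ IsInjectionUpTo o n c) ∧ ∀ x, τ.arr 1 x = 0 ↔ ¬ ∃ i < c, o i = x)
      (fun c _ τ hτ => hτ.2.1) (fun c hc τ hτ => ?_) ?_).mono le_rfl fun τ hτ =>
        ⟨hτ.1, hτ.2.2.2.1⟩
  · obtain ⟨hs, h2, h3, h4, h5⟩ := hτ
    refine Runs.le (T₁ := 1 + (1 + (4 + (1 + (1 + 1))))) ?_ (by omega)
    refine runs_seq <| runs_load <| runs_seq <| runs_sub <| Runs.seq (R := fun τ' =>
      CheckState w o n m m' τ' ∧ τ'.reg 2 = n - c ∧ τ'.reg 3 = c ∧ τ'.reg 9 = o c ∧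
      (τ'.reg 4 = 0 ↔ IsInjectionUpTo o n (c + 1)) ∧ τ'.arr 1 = τ.arr 1) ?_ fun τ' hτ' => ?_
    · have hs' := (hs.setReg (i := 9) (by decide) (o c)).setReg (i := 10) (by decide) (n - o c)
      rw [isInjectionUpTo_succ]
      refine runs_ite (T := 3) (fun hlt => (runs_seq (T₂ := 2) <| runs_load <|
        runs_ite (T := 1) (fun hm => runs_const ?_) fun hm => runs_const ?_).le (by omega))
        fun hge => (runs_const ?_).le (by omega)
      · simp only [RamState.reg_setReg, RamState.arr_setReg, hs.verts, hs.map, h3] at hlt hm ⊢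
        refine ⟨(hs'.setReg (by decide) _).setReg (by decide) _, by simpa, by simp, by simp, ?_,
          trivial⟩
        have := (h5 (o c)).not.1 (by simpa using hm)
        simp only [if_true, one_ne_zero, false_iff]
        exact fun h => this h.2.2
      · simp only [RamState.reg_setReg, RamState.arr_setReg, hs.verts, hs.map, h3] at hlt hm ⊢
        refine ⟨(hs'.setReg (by decide) _).setReg (by decide) _, by simpa, by simp, by simp, ?_,
          trivial⟩
        have h₁ := (h5 (o c)).1 (by simpa using hm)
        have h₂ : o c < n := by
          simp only [if_true] at hlt
          simp at hlt
          omega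
        simp only [h₁, h₂, not_false_iff, and_true]
        simpa using h4
      · simp only [RamState.reg_setReg, RamState.arr_setReg, hs.verts, hs.map, h3] at hge ⊢
        refine ⟨hs'.setReg (by decide) _, by simpa, by simp, by simp, ?_, trivial⟩
        have h₂ : ¬ o c < n := by
          simp only [if_true] at hge
          simp at hge
          omega
        simp [h₂]
    · obtain ⟨hs', h2', h3', h9', h4', h5'⟩ := hτ'
      refine runs_seq <| runs_store <| runs_seq <| runs_add <| runs_sub
        ⟨((hs'.setArr_one _ _).setReg (by decide) _).setReg (by decide) _, ?_, ?_, ?_, fun x => ?_⟩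
      · simp only [RamState.reg_setReg, RamState.reg_setArr, h2', hs'.one]
        simp
        omega
      · simp [h3', hs'.one]
      · simpa using h4'
      · simp only [RamState.arr_setReg, RamState.arr_setArr, h9', hs'.one, if_true, h5',
          Function.update_apply]
        by_cases hx : x = o c
        · simp only [hx, if_true, one_ne_zero, false_iff, not_not]
          exact ⟨c, by omega, rfl⟩
        · simp only [hx, if_false, h5, Nat.lt_succ_iff_lt_or_eq]
          refine not_congr ⟨fun ⟨i, hi, e⟩ => ⟨i, .inl hi, e⟩, ?_⟩
          rintro ⟨i, hi | rfl, e⟩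
          exacts [⟨i, hi, e⟩, (hx e.symm).elim]
  · refine ⟨(((h.setReg (by decide) _).setReg (by decide) _).setReg (by decide) _).setReg
      (by decide) _, by simp [h.verts], by simp, by simp [IsInjectionUpTo], by simp [h1]⟩

/-- Run `p` if the registers `a` and `b` agree, else `q`. -/
def ifEq (a b : ℕ) (p q : RamProg) : RamProg :=
  seq (sub 16 a b) <| seq (sub 17 b a) <| seq (add 16 16 17) <| ite 16 q p

/-- Of the two truncated differences one vanishes; their sum is zero exactly for equal registers. -/
theorem runs_ifEq (h : CheckState w o n m m' σ) {a b : ℕ} (ha : a < 16) (hb : b < 16)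
    {p q : RamProg} {T : ℕ} {Q : RamState → Prop}
    (hp : σ.reg a = σ.reg b → ∀ τ, CheckState w o n m m' τ → (∀ i < 16, τ.reg i = σ.reg i) →
      p.Runs τ T Q)
    (hq : σ.reg a ≠ σ.reg b → ∀ τ, CheckState w o n m m' τ → (∀ i < 16, τ.reg i = σ.reg i) →
      q.Runs τ T Q) :
    (ifEq a b p q).Runs σ (T + 4) Q := by
  refine Runs.le (T₁ := 1 + (1 + (1 + (T + 1)))) ?_ (by omega)
  have ha₁ : a ≠ 16 := by omega
  have hb₁ : b ≠ 16 := by omega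
  refine runs_seq <| runs_sub <| runs_seq <| runs_sub <| runs_seq <| runs_add <|
    Runs.mono (T₁ := T + 1) (Q := Q) ?_ le_rfl fun _ => id
  have hs := ((h.setReg (i := 16) (by decide) (σ.reg a - σ.reg b)).setReg (i := 17) (by decide)
    (σ.reg b - σ.reg a)).setReg (i := 16) (by decide)
    (σ.reg a - σ.reg b + (σ.reg b - σ.reg a))
  have hi : ∀ i < 16, (((σ.setReg 16 (σ.reg a - σ.reg b)).setReg 17
      (σ.reg b - σ.reg a)).setReg 16 (σ.reg a - σ.reg b + (σ.reg b - σ.reg a))).reg i =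
      σ.reg i := fun i hi => by
    simp [show i ≠ 16 by omega, show i ≠ 17 by omega]
  simp only [RamState.reg_setReg, ha₁, hb₁, if_true, if_false,
    show (16 : ℕ) ≠ 17 by decide]
  refine runs_ite (fun h₁ => hq ?_ _ hs hi) fun h₁ => hp ?_ _ hs hi
  · simp only [RamState.reg_setReg, if_true] at h₁
    omega
  · simp only [RamState.reg_setReg, if_true] at h₁
    omega

/-- Set register `11` to `1` if the pairs in the registers `9, 10` and `14, 15` are equal up to
order. -/
def compareProg : RamProg :=
  ifEq 9 14 (ifEq 10 15 (const 11 1)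
    (ifEq 9 15 (ifEq 10 14 (const 11 1) (const 16 0)) (const 16 0)))
    (ifEq 9 15 (ifEq 10 14 (const 11 1) (const 16 0)) (const 16 0))

/-- Register `11` is never cleared here, so successive comparisons accumulate a disjunction. -/
theorem runs_compareProg (h : CheckState w o n m m' σ) :
    compareProg.Runs σ 17 fun τ => CheckState w o n m m' τ ∧
      (∀ i < 16, i ≠ 11 → τ.reg i = σ.reg i) ∧
      (τ.reg 11 ≠ 0 ↔ σ.reg 11 ≠ 0 ∨ s(σ.reg 9, σ.reg 10) = s(σ.reg 14, σ.reg 15)) := by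
  set Q : RamState → Prop := fun τ => CheckState w o n m m' τ ∧
      (∀ i < 16, i ≠ 11 → τ.reg i = σ.reg i) ∧
      (τ.reg 11 ≠ 0 ↔ σ.reg 11 ≠ 0 ∨ s(σ.reg 9, σ.reg 10) = s(σ.reg 14, σ.reg 15)) with hQ
  have yes : s(σ.reg 9, σ.reg 10) = s(σ.reg 14, σ.reg 15) → ∀ τ, CheckState w o n m m' τ →
      (∀ i < 16, τ.reg i = σ.reg i) → (const 11 1).Runs τ 1 Q := fun he τ hτ hi =>
    runs_const ⟨hτ.setReg (by decide) _, fun i hi' hne => by simp [hne, hi i hi'], by simp [he]⟩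
  have no : s(σ.reg 9, σ.reg 10) ≠ s(σ.reg 14, σ.reg 15) → ∀ τ, CheckState w o n m m' τ →
      (∀ i < 16, τ.reg i = σ.reg i) → (const 16 0).Runs τ 1 Q := fun he τ hτ hi =>
    runs_const ⟨hτ.setReg (by decide) _,
      fun i hi' hne => by simp [show i ≠ 16 by omega, hi i hi'], by simp [he, hi 11]⟩
  have swapped : ¬ (σ.reg 9 = σ.reg 14 ∧ σ.reg 10 = σ.reg 15) → ∀ τ, CheckState w o n m m' τ →
      (∀ i < 16, τ.reg i = σ.reg i) →
      (ifEq 9 15 (ifEq 10 14 (const 11 1) (const 16 0)) (const 16 0)).Runs τ 9 Q := by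
    intro hne τ hτ hi
    refine runs_ifEq (T := 5) hτ (by decide) (by decide) (fun h₁ τ₁ hτ₁ hi₁ =>
      runs_ifEq (T := 1) hτ₁ (by decide) (by decide) (fun h₂ τ₂ hτ₂ hi₂ => yes ?_ τ₂ hτ₂ ?_)
        fun h₂ τ₂ hτ₂ hi₂ => no ?_ τ₂ hτ₂ ?_) fun h₁ τ₁ hτ₁ hi₁ => (no ?_ τ₁ hτ₁ ?_).le (by omega)
    · rw [hi₁ _ (by decide), hi₁ _ (by decide), hi _ (by decide), hi _ (by decide)] at h₂
      rw [hi _ (by decide), hi _ (by decide)] at h₁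
      rw [h₁, h₂, Sym2.eq_swap]
    · exact fun i h => (hi₂ i h).trans ((hi₁ i h).trans (hi i h))
    · rw [hi₁ _ (by decide), hi₁ _ (by decide), hi _ (by decide), hi _ (by decide)] at h₂
      rw [Ne, Sym2.eq_iff]
      tauto
    · exact fun i h => (hi₂ i h).trans ((hi₁ i h).trans (hi i h))
    · rw [hi _ (by decide), hi _ (by decide)] at h₁
      rw [Ne, Sym2.eq_iff]
      tauto
    · exact fun i h => (hi₁ i h).trans (hi i h)
  refine runs_ifEq (T := 13) h (by decide) (by decide) (fun h₁ τ₁ hτ₁ hi₁ =>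
      runs_ifEq (T := 9) hτ₁ (by decide) (by decide) (fun h₂ τ₂ hτ₂ hi₂ =>
        (yes ?_ τ₂ hτ₂ ?_).le (by omega)) fun h₂ τ₂ hτ₂ hi₂ => swapped ?_ τ₂ hτ₂ ?_)
      fun h₁ τ₁ hτ₁ hi₁ => (swapped (fun h => h₁ h.1) τ₁ hτ₁ hi₁).le (by omega)
  · rw [hi₁ _ (by decide), hi₁ _ (by decide)] at h₂
    rw [h₁, h₂]
  · exact fun i h => (hi₂ i h).trans (hi₁ i h)
  · rw [hi₁ _ (by decide), hi₁ _ (by decide)] at h₂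
    exact fun h => h₂ h.2
  · exact fun i h => (hi₂ i h).trans (hi₁ i h)

/-- Set register `11` to a nonzero value if the pair in the registers `9, 10` is one of the edges
of the second graph. -/
def searchProg : RamProg :=
  seq (const 11 0) <| seq (const 12 0) <| seq (add 12 12 8) <| seq (const 13 3) <|
  seq (add 13 13 7) <| seq (add 13 13 7) <| loop 12 <|
    seq (load 14 0 13) <| seq (add 13 13 1) <| seq (load 15 0 13) <| seq (add 13 13 1) <|
    seq compareProg (sub 12 12 1)

theorem runs_searchProg (h : CheckState w o n m m' σ) :
    searchProg.Runs σ (m' * 23 + 7) fun τ => CheckState w o n m m' τ ∧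
      (∀ i < 11, τ.reg i = σ.reg i) ∧
      (τ.reg 11 ≠ 0 ↔ ∃ j < m', s(σ.reg 9, σ.reg 10) =
        s(w (3 + 2 * m + 2 * j), w (3 + 2 * m + 2 * j + 1))) := by
  refine Runs.le (T₁ := 1 + (1 + (1 + (1 + (1 + (1 + (m' * (22 + 1) + 1))))))) ?_ (by omega)
  refine runs_seq <| runs_const <| runs_seq <| runs_const <| runs_seq <| runs_add <| runs_seq <|
    runs_const <| runs_seq <| runs_add <| runs_seq <| runs_add <|
    -- The second edge list starts after three header words and the 2m words of the first list.
    (runs_loop (fun c τ => CheckState w o n m m' τ ∧ (∀ i < 11, τ.reg i = σ.reg i) ∧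
      τ.reg 12 = m' - c ∧ τ.reg 13 = 3 + 2 * m + 2 * c ∧
      (τ.reg 11 ≠ 0 ↔ ∃ j < c, s(σ.reg 9, σ.reg 10) =
        s(w (3 + 2 * m + 2 * j), w (3 + 2 * m + 2 * j + 1))))
      (fun c _ τ hτ => hτ.2.2.1) (fun c hc τ hτ => ?_) ?_).mono le_rfl fun τ hτ =>
        ⟨hτ.1, hτ.2.1, hτ.2.2.2.2⟩
  · obtain ⟨hs, hi, h12, h13, h11⟩ := hτ
    refine Runs.le (T₁ := 1 + (1 + (1 + (1 + (17 + 1))))) ?_ (by omega)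
    refine runs_seq <| runs_load <| runs_seq <| runs_add <| runs_seq <| runs_load <| runs_seq <|
      runs_add <| Runs.seq (runs_compareProg (w := w) (o := o) (n := n) (m := m) (m' := m') ?_)
      fun τ' ⟨hs', hi', h11'⟩ => runs_sub ⟨hs'.setReg (by decide) _, fun i hlt => ?_, ?_, ?_, ?_⟩
    · exact (((hs.setReg (by decide) _).setReg (by decide) _).setReg (by decide) _).setReg
        (by decide) _
    · rw [RamState.reg_setReg, if_neg (by omega), hi' i (by omega) (by omega), ← hi i hlt]
      simp [show i ≠ 13 by omega, show i ≠ 14 by omega, show i ≠ 15 by omega]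
    · rw [RamState.reg_setReg, if_pos rfl, hs'.one, hi' 12 (by decide) (by decide)]
      simp [h12]
      omega
    · rw [RamState.reg_setReg, if_neg (by decide), hi' 13 (by decide) (by decide)]
      simp [h13, hs.one]
      omega
    · rw [RamState.reg_setReg, if_neg (by decide), h11']
      simp only [RamState.reg_setReg, RamState.arr_setReg, h13, hs.one, hs.input]
      simp only [hi 9 (by decide), hi 10 (by decide), Nat.reduceEqDiff, if_true,
        if_false, h11]
      constructor
      · rintro (⟨j, hj, e⟩ | e)
        exacts [⟨j, by omega, e⟩, ⟨c, by omega, e⟩]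
      · rintro ⟨j, hj, e⟩
        rcases Nat.lt_succ_iff_lt_or_eq.1 hj with hj | rfl
        exacts [.inl ⟨j, hj, e⟩, .inr e]
  · refine ⟨by repeat (first | exact h | refine CheckState.setReg ?_ (by decide) _),
      fun i hi => ?_, by simp [h.edges'], ?_, by simp⟩
    · simp [show i ≠ 11 by omega, show i ≠ 12 by omega, show i ≠ 13 by omega]
    · simp [h.edges]
      omega

/-- Add to register `5` the number `D` for every edge of the first graph that is not mapped to an
edge of the second graph. -/
def countProg (D : ℕ) : RamProg :=
  seq (const 5 0) <| seq (const 2 0) <| seq (add 2 2 7) <| seq (const 3 3) <| loop 2 <|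
    seq (load 9 0 3) <| seq (load 9 3 9) <| seq (add 3 3 1) <| seq (load 10 0 3) <|
    seq (load 10 3 10) <| seq (add 3 3 1) <| seq searchProg <|
    seq (ite 11 (const 11 0) (seq (const 11 D) (add 5 5 11))) (sub 2 2 1)

/-- The edge number `i` of the first graph is mapped to an edge of the second graph. -/
def EdgeFound (w o : ℕ → ℕ) (m m' i : ℕ) : Prop :=
  ∃ j < m', s(o (w (3 + 2 * i)), o (w (3 + 2 * i + 1))) =
    s(w (3 + 2 * m + 2 * j), w (3 + 2 * m + 2 * j + 1))

open Classical in
theorem runs_countProg (h : CheckState w o n m m' σ) (D : ℕ) :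
    (countProg D).Runs σ (m * (m' * 23 + 18) + 5) fun τ => CheckState w o n m m' τ ∧
      τ.reg 4 = σ.reg 4 ∧
      τ.reg 5 = ∑ i ∈ Finset.range m, if EdgeFound w o m m' i then 0 else D := by
  refine Runs.le (T₁ := 1 + (1 + (1 + (1 + (m * (m' * 23 + 17 + 1) + 1)))))
    ?_ (by rw [show m' * 23 + 17 + 1 = m' * 23 + 18 from rfl]; omega)
  refine runs_seq <| runs_const <| runs_seq <| runs_const <| runs_seq <| runs_add <| runs_seq <|
    runs_const <| (runs_loop (fun c τ => CheckState w o n m m' τ ∧ τ.reg 4 = σ.reg 4 ∧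
      τ.reg 2 = m - c ∧ τ.reg 3 = 3 + 2 * c ∧
      τ.reg 5 = ∑ i ∈ Finset.range c, if EdgeFound w o m m' i then 0 else D)
      (fun c _ τ hτ => hτ.2.2.1) (fun c hc τ hτ => ?_) ?_).mono le_rfl fun τ hτ =>
        ⟨hτ.1, hτ.2.1, hτ.2.2.2.2⟩
  · obtain ⟨hs, h4, h2, h3, h5⟩ := hτ
    refine Runs.le (T₁ := 1 + (1 + (1 + (1 + (1 + (1 + ((m' * 23 + 7) + (3 + 1)))))))) ?_ (by omega)
    refine runs_seq <| runs_load <| runs_seq <| runs_load <| runs_seq <| runs_add <| runs_seq <|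
      runs_load <| runs_seq <| runs_load <| runs_seq <| runs_add <|
      Runs.seq (runs_searchProg (w := w) (o := o) (n := n) (m := m) (m' := m') ?_)
      fun τ₁ ⟨hs₁, hi₁, h11⟩ => Runs.seq (R := fun τ' => CheckState w o n m m' τ' ∧
        τ'.reg 4 = σ.reg 4 ∧ τ'.reg 2 = m - c ∧ τ'.reg 3 = 3 + 2 * (c + 1) ∧
        τ'.reg 5 = ∑ i ∈ Finset.range (c + 1), if EdgeFound w o m m' i then 0 else D) ?_
        fun τ' ⟨hs', h4', h2', h3', h5'⟩ =>
          runs_sub ⟨hs'.setReg (by decide) _, by simpa, ?_, by simpa, by simpa⟩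
    · repeat (first | exact hs | refine CheckState.setReg ?_ (by decide) _)
    · have e2 := hi₁ 2 (by decide)
      have e3 := hi₁ 3 (by decide)
      have e4 := hi₁ 4 (by decide)
      have e5 := hi₁ 5 (by decide)
      simp only [RamState.reg_setReg, RamState.arr_setReg, h3, hs.one, hs.input, hs.map,
        Nat.reduceEqDiff, if_true, if_false, h2, h4, h5] at e2 e3 e4 e5 h11
      rw [show 3 + 2 * c + 1 + 1 = 3 + 2 * (c + 1) by omega] at e3
      rw [Finset.sum_range_succ]
      refine runs_ite (T := 2) (fun hne => (runs_const ?_).le (by omega)) fun h0 =>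
        runs_seq (T₁ := 1) (T₂ := 1) <| runs_const <| runs_add ?_
      · refine ⟨hs₁.setReg (by decide) _, by simpa, by simpa, by simpa, ?_⟩
        have hf : EdgeFound w o m m' c := h11.1 hne
        simpa [hf] using e5
      · refine ⟨(hs₁.setReg (by decide) _).setReg (by decide) _, by simpa, by simpa, by simpa, ?_⟩
        have hf : ¬ EdgeFound w o m m' c := fun hf => h11.2 hf h0
        simp [hf, e5]
    · rw [RamState.reg_setReg, if_pos rfl, h2', hs'.one]
      omega
  · refine ⟨by repeat (first | exact h | refine CheckState.setReg ?_ (by decide) _),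
      by simp, by simp [h.edges], by simp, by simp⟩

/-- Copy the input into array `2`. -/
def copyProg : RamProg :=
  seq (const 1 1) <| seq (load 6 0 0) <| seq (load 7 0 1) <| seq (const 9 2) <|
  seq (load 8 0 9) <| seq (const 2 3) <| seq (add 2 2 7) <| seq (add 2 2 7) <| seq (add 2 2 8) <|
  seq (add 2 2 8) <| loop 2 <| seq (load 9 0 3) <| seq (store 2 3 9) <| seq (add 3 3 1) (sub 2 2 1)

/-- The memory after copying. -/
structure CopyState (w : List ℕ) (n m m' : ℕ) (v : List ℕ) (τ : RamState) : Prop where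
  one : τ.reg 1 = 1
  verts : τ.reg 6 = n
  edges : τ.reg 7 = m
  edges' : τ.reg 8 = m'
  input : τ.arr 0 = fun x => w.getD x 0
  marks : τ.arr 1 = fun _ => 0
  copy : τ.arr 2 = fun x => v.getD x 0
  high_reg : ∀ i, 20 ≤ i → τ.reg i = 0
  high_arr : ∀ a, 3 ≤ a → τ.arr a = fun _ => 0

/-- The checked program may overwrite its input, while the check needs the original. The program
therefore works on the copy, and after the shift by two arrays its output lands in array 3. -/
theorem runs_copyProg {w : List ℕ} (n m m' : ℕ) (hw : w.length = 2 * m + 2 * m') :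
    copyProg.Runs (RamState.initial (n :: m :: m' :: w)) ((2 * m + 2 * m' + 3) * 5 + 11)
      (CopyState (n :: m :: m' :: w) n m m' (n :: m :: m' :: w)) := by
  set v := n :: m :: m' :: w with hv
  have hlen : v.length = 2 * m + 2 * m' + 3 := by simp [hv, hw]
  have e0 : v.getD 0 0 = n := rfl
  have e1 : v.getD 1 0 = m := rfl
  have e2 : v.getD 2 0 = m' := rfl
  refine Runs.le (T₁ := 1 + (1 + (1 + (1 + (1 + (1 + (1 + (1 + (1 + (1 +
    (v.length * (4 + 1) + 1))))))))))) ?_ (by omega)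
  refine runs_seq <| runs_const <| runs_seq <| runs_load <| runs_seq <| runs_load <| runs_seq <|
    runs_const <| runs_seq <| runs_load <| runs_seq <| runs_const <| runs_seq <| runs_add <|
    runs_seq <| runs_add <| runs_seq <| runs_add <| runs_seq <| runs_add <|
    (runs_loop (fun c τ => CopyState v n m m' (v.take c) τ ∧ τ.reg 2 = v.length - c ∧ τ.reg 3 = c)
      (fun c _ τ hτ => hτ.2.1) (fun c hc τ hτ => ?_) ?_).mono le_rfl fun τ hτ => by
        simpa using hτ.1
  · obtain ⟨⟨h1, h6, h7, h8, h0, hm, h2, hr, ha⟩, hc2, hc3⟩ := hτ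
    refine Runs.le (T₁ := 1 + (1 + (1 + 1))) ?_ (by omega)
    refine runs_seq <| runs_load <| runs_seq <| runs_store <| runs_seq <| runs_add <| runs_sub ?_
    refine ⟨⟨by simpa, by simpa, by simpa, by simpa, by simpa, by simpa, ?_, fun i hi => ?_,
      fun a ha' => ?_⟩, ?_, ?_⟩
    · have := List.update_getD_length (v.take c) (v.getD c 0)
      rw [List.length_take_of_le hc.le] at this
      simp only [RamState.arr_setReg, RamState.arr_setArr, if_true, h2, h0, RamState.reg_setReg,
        hc3, show (3 : ℕ) ≠ 9 by decide, if_false]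
      rw [this, List.take_add_one, List.getD_eq_getElem _ _ hc]
      simp [hc]
    · simp [show i ≠ 2 by omega, show i ≠ 3 by omega, show i ≠ 9 by omega, hr i hi]
    · simp [show a ≠ 2 by omega, ha a ha']
    · simp [hc2, h1]
      omega
    · simp [hc3, h1]
  · refine ⟨⟨by simp, ?_, ?_, ?_, ?_, ?_, ?_, fun i hi => ?_, fun a ha => ?_⟩, ?_, ?_⟩
    · simp [RamState.initial, hv]
    · simp [RamState.initial, hv]
    · simp [RamState.initial, hv]
    · simp [RamState.initial]
    · simp [RamState.initial]
    · simp [RamState.initial]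
    · simp [RamState.initial, show i ≠ 2 by omega, show i ≠ 8 by omega, show i ≠ 9 by omega,
        show i ≠ 7 by omega, show i ≠ 6 by omega, show i ≠ 1 by omega]
    · simp [RamState.initial, show a ≠ 0 by omega]
    · simp [RamState.initial, hv]
      omega
    · simp [RamState.initial]

/-- Run `P` and check its output. -/
def verifyProg (P : RamProg) (D : ℕ) : RamProg :=
  seq copyProg <| seq (P.shift 20 2) <| seq injectionProg <| seq (countProg D) <|
  seq (sub 9 5 7) <| seq (add 9 9 4) <| ite 9 (const 0 0) (const 0 1)

-- The approximation is tested in integers: D times the number of lost edges must not exceed m. The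
-- truncated difference is added to the injectivity flag, so one test for zero covers both
-- conditions.
open Classical in
theorem runs_verifyProg {P : RamProg} {w : List ℕ} (hw : w.length = 2 * m + 2 * m') {T : ℕ}
    (hP : P.HaltsWithin (n :: m :: m' :: w) T) (hσ : P.HaltsWith (n :: m :: m' :: w) σ) (D : ℕ) :
    (verifyProg P D).Runs (RamState.initial (n :: m :: m' :: w))
      (((2 * m + 2 * m' + 3) * 5 + 11) + (T + ((n * 10 + 5) + ((m * (m' * 23 + 18) + 5) + 4))))
      fun τ => τ.reg 0 ≠ 0 ↔ IsInjectionUpTo (σ.arr 1) n n ∧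
        (∑ i ∈ Finset.range m, if EdgeFound (fun x => (n :: m :: m' :: w).getD x 0) (σ.arr 1) m m' i
          then 0 else D) ≤ m := by
  refine (runs_copyProg n m m' hw).seq fun τ h => ?_
  refine ((hP.runs hσ).shift 20 2 ⟨fun i => ?_, fun a => ?_⟩).seq fun τ₁ ⟨σ', hσ', h₁, hb⟩ => ?_
  · simpa [RamState.initial] using h.high_reg (i + 20) (by omega)
  · rcases a with - | a
    · simpa [RamState.initial] using h.copy
    · simpa [RamState.initial] using h.high_arr (a + 1 + 2) (by omega)
  subst hσ'
  have hs : CheckState (fun x => (n :: m :: m' :: w).getD x 0) (σ'.arr 1) n m m' τ₁ :=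
    ⟨by rw [hb.reg 1 (by decide), h.one], by rw [hb.reg 6 (by decide), h.verts],
      by rw [hb.reg 7 (by decide), h.edges], by rw [hb.reg 8 (by decide), h.edges'],
      by rw [hb.arr 0 (by decide), h.input], h₁.arr 1⟩
  refine (runs_injectionProg hs (by rw [hb.arr 1 (by decide), h.marks])).seq
    fun τ₂ ⟨hs₂, h₂⟩ => (runs_countProg hs₂ D).seq fun τ₃ ⟨hs₃, h4, h5⟩ => ?_
  refine Runs.le (T₁ := 1 + (1 + (1 + 1))) (runs_seq <| runs_sub <| runs_seq <| runs_add <|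
    runs_ite (fun hne => runs_const ?_) fun h0 => runs_const ?_) (by omega)
  · simp only [RamState.reg_setReg, if_true, h4, hs₃.edges, h5, Nat.reduceEqDiff,
      if_false] at hne
    rw [← h₂]
    simp only [RamState.reg_setReg, if_true, ne_eq, not_true_eq_false, false_iff]
    omega
  · simp only [RamState.reg_setReg, if_true, h4, hs₃.edges, h5, Nat.reduceEqDiff,
      if_false] at h0
    rw [← h₂]
    simp only [RamState.reg_setReg, if_true, ne_eq, one_ne_zero, not_false_eq_true, true_iff]
    omega

end RamProg

/-! ## From robust graph isomorphism to distinguishing pairs of graphs -/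

section Robust

variable {n : ℕ} {G G' : SimpleGraph (Fin n)} {l l' : List (Fin n × Fin n)}

theorem getD_edgeWords (l : List (Fin n × Fin n)) {i : ℕ} (hi : i < l.length) :
    (edgeWords l).getD (2 * i) 0 = l[i].1 ∧ (edgeWords l).getD (2 * i + 1) 0 = l[i].2 := by
  have h := fun j hj => List.getD_flatMap_of_length (L := 2)
    (g := fun p : Fin n × Fin n => [(p.1 : ℕ), (p.2 : ℕ)]) (fun _ => rfl) l hi (i := j) hj
  exact ⟨h 0 (by decide), h 1 (by decide)⟩

theorem length_edgeWords (l : List (Fin n × Fin n)) : (edgeWords l).length = 2 * l.length := by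
  simp [edgeWords, List.length_flatMap, Nat.mul_comm]

/-- The input words of a pair of edge lists. -/
abbrev pairWords (l l' : List (Fin n × Fin n)) : List ℕ :=
  n :: l.length :: l'.length :: (edgeWords l ++ edgeWords l')

theorem getD_pairWords_left {i : ℕ} (hi : i < l.length) :
    (pairWords l l').getD (3 + 2 * i) 0 = l[i].1 ∧
      (pairWords l l').getD (3 + 2 * i + 1) 0 = l[i].2 := by
  have h := getD_edgeWords l hi
  have hl := length_edgeWords l
  rw [← h.1, ← h.2, show 3 + 2 * i = 2 * i + 1 + 1 + 1 by omega]
  simp only [pairWords, List.getD_cons_succ]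
  exact ⟨List.getD_append _ _ _ _ (by omega), List.getD_append _ _ _ _ (by omega)⟩

theorem getD_pairWords_right {j : ℕ} (hj : j < l'.length) :
    (pairWords l l').getD (3 + 2 * l.length + 2 * j) 0 = l'[j].1 ∧
      (pairWords l l').getD (3 + 2 * l.length + 2 * j + 1) 0 = l'[j].2 := by
  have h := getD_edgeWords l' hj
  have hl := length_edgeWords l
  rw [← h.1, ← h.2, show 3 + 2 * l.length + 2 * j = 2 * l.length + 2 * j + 1 + 1 + 1 by omega]
  simp only [pairWords, List.getD_cons_succ]
  rw [List.getD_append_right _ _ _ _ (by omega), List.getD_append_right _ _ _ _ (by omega), hl]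
  exact ⟨by rw [Nat.add_sub_cancel_left], by rw [Nat.add_assoc, Nat.add_sub_cancel_left]⟩

theorem edgeFound_iff (hl' : IsEdgeListing G' l') {o : ℕ → ℕ} {π : Fin n ≃ Fin n}
    (ho : ∀ v : Fin n, o v = π v) {i : ℕ} (hi : i < l.length) :
    RamProg.EdgeFound (fun x => (pairWords l l').getD x 0) o l.length l'.length i ↔
      (s(l[i].1, l[i].2)).map π ∈ G'.edgeSet := by
  rw [← hl'.2, List.mem_map, RamProg.EdgeFound]
  simp only [(getD_pairWords_left (l' := l') hi).1, (getD_pairWords_left (l' := l') hi).2, ho]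
  have hval : ∀ a b c d : Fin n, s((a : ℕ), (b : ℕ)) = s((c : ℕ), (d : ℕ)) ↔ s(c, d) = s(a, b) :=
    fun a b c d => by
      simp only [Sym2.eq_iff, Fin.val_inj]
      tauto
  constructor
  · rintro ⟨j, hj, e⟩
    rw [(getD_pairWords_right hj).1, (getD_pairWords_right hj).2, hval] at e
    exact ⟨l'[j], List.getElem_mem hj, e⟩
  · rintro ⟨p, hp, e⟩
    obtain ⟨j, hj, rfl⟩ := List.getElem_of_mem hp
    refine ⟨j, hj, ?_⟩
    rw [(getD_pairWords_right hj).1, (getD_pairWords_right hj).2, hval]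
    exact e

/-- An edge list lists different edges. -/
theorem IsEdgeListing.injective (hl : IsEdgeListing G l) :
    Function.Injective fun i : Fin l.length => s(l[i].1, l[i].2) := by
  intro i j h
  have := List.nodup_iff_injective_get.1 hl.1
  have h' := @this ⟨i, by simp⟩ ⟨j, by simp⟩ (by simpa using h)
  exact Fin.ext (by simpa using h')

theorem IsEdgeListing.range (hl : IsEdgeListing G l) :
    (Set.range fun i : Fin l.length => s(l[i].1, l[i].2)) = G.edgeSet := by
  ext e
  rw [← hl.2, List.mem_map, Set.mem_range]
  constructor
  · rintro ⟨i, rfl⟩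
    exact ⟨l[i], List.getElem_mem i.2, rfl⟩
  · rintro ⟨p, hp, rfl⟩
    obtain ⟨i, hi, rfl⟩ := List.getElem_of_mem hp
    exact ⟨⟨i, hi⟩, rfl⟩

/-- The number of edges is the length of an edge list. -/
theorem IsEdgeListing.ncard_edgeSet (hl : IsEdgeListing G l) : G.edgeSet.ncard = l.length := by
  rw [← hl.range, ← Set.image_univ, Set.ncard_image_of_injective _ hl.injective, Set.ncard_univ,
    Nat.card_fin]

open Classical in
/-- The number that `countProg` computes. -/
theorem sum_edgeFound (hl : IsEdgeListing G l) (hl' : IsEdgeListing G' l') {o : ℕ → ℕ}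
    {π : Fin n ≃ Fin n} (ho : ∀ v : Fin n, o v = π v) (D : ℕ) :
    (∑ i ∈ Finset.range l.length, if RamProg.EdgeFound (fun x => (pairWords l l').getD x 0) o
      l.length l'.length i then 0 else D) +
      D * {e ∈ G.edgeSet | e.map π ∈ G'.edgeSet}.ncard = D * l.length := by
  set F : Set (Fin l.length) := {i | (s(l[i].1, l[i].2)).map π ∈ G'.edgeSet} with hF
  have h₁ : {e ∈ G.edgeSet | e.map π ∈ G'.edgeSet}.ncard = F.ncard := by
    rw [← Set.ncard_image_of_injective _ hl.injective]
    congr 1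
    ext e
    simp only [← hl.range, Set.mem_ofPred_eq, Set.mem_range, Set.mem_image, hF]
    constructor
    · rintro ⟨⟨i, rfl⟩, h⟩
      exact ⟨i, h, rfl⟩
    · rintro ⟨i, h, rfl⟩
      exact ⟨⟨i, rfl⟩, h⟩
  have h₂ := Set.ncard_add_ncard_compl F
  rw [Nat.card_fin] at h₂
  have h₃ : (∑ i ∈ Finset.range l.length, if RamProg.EdgeFound
      (fun x => (pairWords l l').getD x 0) o l.length l'.length i then 0 else D) =
      D * Fᶜ.ncard := by
    rw [Finset.sum_range, Set.ncard_eq_toFinset_card', mul_comm, ← smul_eq_mul, ← Finset.sum_const,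
      ← Finset.sum_filter_add_sum_filter_not Finset.univ (fun i : Fin l.length => i ∈ F)]
    rw [Finset.sum_eq_zero, zero_add]
    · refine Finset.sum_congr (by ext; simp) fun i hi => ?_
      rw [if_neg]
      rw [edgeFound_iff hl' ho i.2]
      simpa [hF] using hi
    · intro i hi
      rw [if_pos]
      rw [edgeFound_iff hl' ho i.2]
      exact (Finset.mem_filter.1 hi).2
  rw [h₁, h₃, ← Nat.mul_add, Nat.add_comm, h₂]

theorem isApproxIso_one_sub_iff {m : ℕ} (hG : G.edgeSet.ncard = m) (hG' : G'.edgeSet.ncard = m)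
    {D : ℕ} (hD : 0 < D) (π : Fin n ≃ Fin n) :
    IsApproxIso (1 - 1 / D) G G' π ↔
      D * m ≤ m + D * {e ∈ G.edgeSet | e.map π ∈ G'.edgeSet}.ncard := by
  rw [IsApproxIso, graphIsoValue, hG, hG', max_self]
  have hD' : (0 : ℝ) < D := by exact_mod_cast hD
  split_ifs with h
  · simp [h]
  · rw [le_div_iff₀ (by exact_mod_cast Nat.pos_of_ne_zero h), ← Nat.cast_le (α := ℝ)]
    generalize {e ∈ G.edgeSet | e.map π ∈ G'.edgeSet}.ncard = x
    push_cast
    constructor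
    · intro h
      have := mul_le_mul_of_nonneg_left h hD'.le
      have e : (D : ℝ) * ((1 - 1 / D) * m) = D * m - m := by field_simp
      linarith
    · intro h
      refine le_of_mul_le_mul_left ?_ hD'
      have e : (D : ℝ) * ((1 - 1 / D) * m) = D * m - m := by field_simp
      linarith

/-- A map that passes the injectivity check is a permutation. -/
theorem RamProg.IsInjectionUpTo.exists_equiv {o : ℕ → ℕ} (h : RamProg.IsInjectionUpTo o n n) :
    ∃ π : Fin n ≃ Fin n, ∀ v : Fin n, o v = π v := by
  let f : Fin n → Fin n := fun v => ⟨o v, h.1 v v.2⟩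
  have hf : f.Injective := fun u v e => Fin.ext (h.2 u u.2 v v.2 (Fin.mk.inj e))
  exact ⟨Equiv.ofBijective f (Finite.injective_iff_bijective.1 hf), fun v => rfl⟩

theorem RamProg.isInjectionUpTo_of_equiv {o : ℕ → ℕ} {π : Fin n ≃ Fin n}
    (h : ∀ v : Fin n, o v = π v) : RamProg.IsInjectionUpTo o n n := by
  refine ⟨fun i hi => ?_, fun i hi j hj e => ?_⟩
  · rw [h ⟨i, hi⟩]
    exact (π _).2
  · rw [h ⟨i, hi⟩, h ⟨j, hj⟩] at e
    simpa using π.injective (Fin.ext e)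

/-- A solution of the robust graph isomorphism problem distinguishes pairs of graphs. -/
theorem distinguishes_verifyProg {P : RamProg} {p : ℕ → ℕ}
    (hp : ∀ (n : ℕ) (G G' : SimpleGraph (Fin n)) (w : List ℕ),
      IsPairEncoding G G' w → P.HaltsWithin w (p n)) {ε r : ℝ} {D : ℕ} (hD : 0 < D)
    (hr : r ≤ 1 / D)
    (hP : ∀ (n : ℕ) (G G' : SimpleGraph (Fin n)) (w : List ℕ),
      IsPairEncoding G G' w → ApproxIsomorphic (1 - ε) G G' →
      ∃ σ, P.HaltsWith w σ ∧ ∃ π : Fin n ≃ Fin n, (∀ v : Fin n, σ.arr 1 v = (π v : ℕ)) ∧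
        IsApproxIso (1 - r) G G' π) (K : ℕ) :
    Distinguishes (RamProg.verifyProg P D) ε (1 / D) K fun n =>
      ((2 * (K * n) + 2 * (K * n) + 3) * 5 + 11) + (p n + ((n * 10 + 5) +
        ((K * n * (K * n * 23 + 18) + 5) + 4))) := by
  classical
  intro n m G G' w hG hG' hm hw
  have hT := hp n G G' w hw
  have hsol := hP n G G' w hw
  obtain ⟨l, l', hl, hl', rfl⟩ := hw
  have hlm : l.length = m := hl.ncard_edgeSet.symm.trans hG
  have hlm' : l'.length = m := hl'.ncard_edgeSet.symm.trans hG'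
  have run := fun {σ} hσ => RamProg.runs_verifyProg (P := P) (σ := σ) (n := n) (m := l.length)
    (m' := l'.length) (w := edgeWords l ++ edgeWords l')
    (by rw [List.length_append, length_edgeWords, length_edgeWords]) hT hσ D
  have hcheck : ∀ {o : ℕ → ℕ} {π : Fin n ≃ Fin n}, (∀ v : Fin n, o v = π v) →
      ((∑ i ∈ Finset.range l.length, if RamProg.EdgeFound
        (fun x => (pairWords l l').getD x 0) o l.length l'.length i then 0 else D) ≤ l.length ↔
        IsApproxIso (1 - 1 / D) G G' π) := fun {o π} ho => by
    rw [isApproxIso_one_sub_iff hG hG' hD]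
    have := sum_edgeFound hl hl' ho D
    rw [← hlm]
    omega
  refine ⟨?_, fun h => ?_, fun h => ?_⟩
  · obtain ⟨s, hs, σ, e⟩ := id hT
    refine ((run ⟨s, e⟩).le ?_).haltsWithin
    rw [hlm, hlm']
    dsimp only
    gcongr
  · obtain ⟨σ, hσ, π, hπ, hiso⟩ := hsol h
    refine ((run hσ).mono le_rfl fun τ hτ => hτ.2 ⟨RamProg.isInjectionUpTo_of_equiv hπ, ?_⟩).accepts
    refine (hcheck hπ).2 (le_trans ?_ hiso)
    linarith
  -- Without any promise on the pair the program still halts by its time bound. Output that passed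
  -- the check would itself be a (1 - 1/D)-isomorphism.
  · obtain ⟨s, hs, σ, e⟩ := id hT
    refine ((run ⟨s, e⟩).mono le_rfl fun τ hτ => ?_).rejects
    by_contra hne
    obtain ⟨hinj, hsum⟩ := hτ.1 hne
    obtain ⟨π, hπ⟩ := hinj.exists_equiv
    exact h ⟨π, (hcheck hπ).1 hsum⟩

end Robust

theorem mainTheorem6 {H : Type*} [AddCommGroup H] [Fintype H] {k : ℕ} (hk : 3 ≤ k)
    (ψ : Set (Fin k → H)) (hψ : IsBalancedPairwiseIndependentSubgroup ψ)
    (hproper : ψ ≠ Set.univ) :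
    (RandomAdditiveCSPHypothesis ψ →
      ¬ ∃ P : RamProg, IsPolyTimeOnGraphPairs P ∧ SolvesRobustGiso P) ∧
    ∃ δ : ℝ, 0 < δ ∧ ∃ Δ K a b : ℕ, 0 < Δ ∧
      ∀ (ε : ℝ) (t : ℕ → ℕ), 0 < ε → (∀ n, n ≤ t n) →
        (∃ P : RamProg, Distinguishes P ε δ K t) →
        ∃ P' : RamProg, IsRefuter ψ ε Δ (fun n => a * t (b * n) + a) P' := by
  obtain ⟨S, rfl⟩ := hψ.subgroup
  have hS : S ≠ ⊤ := fun h => hproper (by rw [h, AddSubgroup.coe_top])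
  obtain ⟨D, hD, Δ, K, a, b, hΔ, href⟩ := exists_refuter_of_distinguishes hk hS
  have hD' : (0 : ℝ) < 1 / D := one_div_pos.2 (by exact_mod_cast hD)
  refine ⟨?_, 1 / D, hD', Δ, K, a, b, hΔ, href⟩
  rintro hyp ⟨P, ⟨p, hp⟩, r, hr, hP⟩
  -- As r(ε) → 0, some ε > 0 has loss r(ε) below the gap 1/D.
  have hev : ∀ᶠ ε in 𝓝[>] (0 : unitInterval), (r ε : ℝ) < 1 / D := by
    have hcont : Tendsto (fun ε => (r ε : ℝ)) (𝓝[>] (0 : unitInterval)) (𝓝 0) :=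
      (continuous_subtype_val.tendsto (0 : unitInterval)).comp hr
    exact hcont.eventually (gt_mem_nhds hD')
  have : (𝓝[>] (0 : unitInterval)).NeBot :=
    nhdsGT_neBot_of_exists_gt ⟨1, zero_lt_one⟩
  obtain ⟨ε, hε, hε0⟩ := (hev.and self_mem_nhdsWithin).exists
  have hdis := distinguishes_verifyProg hp hD hε.le (hP ε) K
  have hε' : (0 : ℝ) < ε := hε0
  obtain ⟨P', hP'⟩ := href ε _ hε' (fun n => by omega) ⟨_, hdis⟩
  -- The time bound of the checked program, as a polynomial in n: the edge numbers are replaced by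
  -- K·n, so the quadratic search stays polynomial.
  let T : Polynomial ℕ := ((2 * (.C K * .X) + 2 * (.C K * .X) + 3) * 5 + 11) +
    (p + ((.X * 10 + 5) + ((.C K * .X * (.C K * .X * 23 + 18) + 5) + 4)))
  refine hyp ε Δ hε' hΔ ⟨P', .C a * T.comp (.C b * .X) + .C a, ?_⟩
  convert hP' using 2 with n
  simp [T]
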